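/- Let $q$ be a power of a prime and let $\Phi$ be the root system of type $D_4$ with simple roots $\alpha_1,\alpha_2,\alpha_3,\alpha_4$, where $\alpha_3$ is the central node of the Dynkin diagram. Write $c_1c_2c_3c_4$ for $\sum_i c_i\alpha_i$. The set $\Phi_+$ of positive roots consists of $\alpha_1,\dots,\alpha_4$ and $\alpha_5=1010$, $\alpha_6=0110$, $\alpha_7=0011$, $\alpha_8=1110$, $\alpha_9=1011$, $\alpha_{10}=0111$, $\alpha_{11}=1111$, $\alpha_{12}=1121$; the height $\operatorname{ht}$ of a positive root is the sum of its coefficients. Let $U$ be the subgroup of the Chevalley group $D_4(q)$ generated by the root elements $x_\alpha(t)=\exp(t\operatorname{ad}e_\alpha)$, $\alpha\in\Phi_+$, $t\in\mathbb F_q$ (for a Chevalley basis containing the $e_\alpha$), and let $X_\alpha=\langle x_\alpha(t)\mid t\in\mathbb F_q\rangle$. Fix a nontrivial linear character $\phi$ of $(\mathbb F_q,+)$, and for $\alpha\in\Phi_+$ and $s\in\mathbb F_q$ let $\varphi_{\alpha,s}$ be the linear character $x_\alpha(d)\mapsto\phi(sd)$ of $X_\alpha$. For $\alpha\in\Phi_+$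 let $h_\alpha=\{\gamma\in\Phi_+\mid \gamma+\gamma'=\alpha\text{ for some }\gamma'\in\Phi_+\cup\{0\}\}$. Let $\operatorname{arm}(\alpha)=(h_\alpha\cap h_{\alpha_{12}})\setminus\{\alpha\}$ if $\alpha\ne\alpha_{12}$, and $\operatorname{arm}(\alpha_{12})=\{\alpha_8,\alpha_9,\alpha_{10},\alpha_{11}\}$. Let $\operatorname{leg}(\alpha)=h_\alpha\setminus(\operatorname{arm}(\alpha)\cup\{\alpha\})$, and let $V_\alpha=\prod_{\gamma\in\Phi_+\setminus\operatorname{leg}(\alpha)}X_\gamma$, the factors being taken in the order of the numbering $\alpha_1,\dots,\alpha_{12}$. **Proposition.** Let $\alpha\in\Phi_+$. The set $V_\alpha$ is a subgroup of $U$ (namely the subgroup generated by the $X_\gamma$ with $\gamma\in\Phi_+\setminus\operatorname{leg}(\alpha)$), and for each $s\in\mathbb F_q^\times$ there is a linear character $\lambda_{\alpha,s}$ of $V_\alpha$ such that $\lambda_{\alpha,s}|_{X_\alpha}=\varphi_{\alpha,s}$ and $X_\gamma\subseteq\ker(\lambda_{\alpha,s})$ for all $\gamma\in\Phi_+$ with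 $\operatorname{ht}(\gamma)>\operatorname{ht}(\alpha)$. For every choice of such characters $\lambda_{\alpha,s}$, $s\in\mathbb F_q^\times$, the induced characters (midafis) $\mu_{\alpha,s}:=\lambda_{\alpha,s}^U$ are $q-1$ distinct irreducible complex characters of $U$, and $$\mu_{\alpha,s}|_{X_\alpha}=\mu_{\alpha,s}(1)\cdot\varphi_{\alpha,s}\qquad\text{for all } s\in\mathbb F_q^\times .$$ -/

import Mathlib

/-!
The maximal unipotent subgroup `U` of the Chevalley group of type `D₄` over a finite field, in its
action on the Lie algebra, together with the hooks, the subgroups `V_α` and the class functions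
needed for the midafis.

Roots are written in coordinates with respect to the simple roots `α₁, α₂, α₃, α₄`, where `α₃` is
the central node of the Dynkin diagram; the vector `(c₁, c₂, c₃, c₄)` is
`c₁ α₁ + c₂ α₂ + c₃ α₃ + c₄ α₄`.
-/

namespace D4

/-! ### The root system -/

/-- The Cartan matrix of type `D₄`; the third node is the central one. -/
def cartan : Matrix (Fin 4) (Fin 4) ℤ :=
  !![2, 0, -1, 0; 0, 2, -1, 0; -1, -1, 2, -1; 0, 0, -1, 2]

/-- The scalar product on the root lattice, normalised so that roots have squared length `2`. Since
all roots have the same length, `form r s` is the Cartan integer of the roots `r`, `s`. -/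
def form (v w : Fin 4 → ℤ) : ℤ := ∑ i, ∑ j, v i * cartan i j * w j

/-- The root system `Φ` of type `D₄`: the vectors of squared length `2` of the root lattice. -/
def roots : Set (Fin 4 → ℤ) := {v | form v v = 2}

/-- The set `Φ₊` of positive roots. -/
def posRoots : Set (Fin 4 → ℤ) := {v | v ∈ roots ∧ ∀ i, 0 ≤ v i}

/-- The height of a root. -/
def height (v : Fin 4 → ℤ) : ℤ := ∑ i, v i

/-- The numbering `α₁, …, α₁₂` of the positive roots (`rootVec i` is `α_{i+1}`). -/
def rootVec : Fin 12 → Fin 4 → ℤ :=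
  ![![1, 0, 0, 0], ![0, 1, 0, 0], ![0, 0, 1, 0], ![0, 0, 0, 1],
    ![1, 0, 1, 0], ![0, 1, 1, 0], ![0, 0, 1, 1],
    ![1, 1, 1, 0], ![1, 0, 1, 1], ![0, 1, 1, 1],
    ![1, 1, 1, 1], ![1, 1, 2, 1]]

instance (v : Fin 4 → ℤ) : Decidable (v ∈ roots) :=
  inferInstanceAs (Decidable (form v v = 2))

theorem form_self (v : Fin 4 → ℤ) :
    form v v = 2 * (v 0 ^ 2 + v 1 ^ 2 + v 2 ^ 2 + v 3 ^ 2 - v 2 * (v 0 + v 1 + v 3)) := by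
  simp [form, cartan, Fin.sum_univ_four]
  ring

theorem rootVec_mem (i : Fin 12) : rootVec i ∈ posRoots := by
  fin_cases i <;> exact ⟨by decide, by decide⟩

theorem neg_mem_roots {v : Fin 4 → ℤ} (h : v ∈ roots) : -v ∈ roots := by
  have h' : form v v = 2 := h
  change form (-v) (-v) = 2
  rw [form_self] at h' ⊢
  simp only [Pi.neg_apply]
  linarith

theorem sub_form (v w : Fin 4 → ℤ) :
    form (v - w) (v - w) = form v v - 2 * form w v + form w w := by
  simp [form, cartan, Fin.sum_univ_four]
  ring

/-- The roots as a type. -/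
abbrev Root : Type := {v : Fin 4 → ℤ // v ∈ roots}

/-- The positive roots as a type. -/
abbrev PosRoot : Type := {v : Fin 4 → ℤ // v ∈ posRoots}

/-- A positive root is a root. -/
def PosRoot.toRoot (α : PosRoot) : Root := ⟨α.1, α.2.1⟩

/-- The positive root `α_{i+1}`. -/
def posRoot (i : Fin 12) : PosRoot := ⟨rootVec i, rootVec_mem i⟩

/-- The negative of a root. -/
def Root.neg (r : Root) : Root := ⟨-r.1, neg_mem_roots r.2⟩

theorem finite_roots : roots.Finite := by
  refine Set.Finite.subset (Set.Finite.pi (t := fun _ : Fin 4 => Set.Icc (-2 : ℤ) 2)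
    fun _ => Set.finite_Icc _ _) ?_
  intro v hv
  have h : form v v = 2 := hv
  rw [form_self] at h
  have e : (2 * v 0 - v 2) ^ 2 + (2 * v 1 - v 2) ^ 2 + (2 * v 3 - v 2) ^ 2 + v 2 ^ 2 = 4 := by
    linarith
  have h2 := abs_le_of_sq_le_sq' (a := v 2) (b := 2)
    (by nlinarith [sq_nonneg (2 * v 0 - v 2), sq_nonneg (2 * v 1 - v 2),
      sq_nonneg (2 * v 3 - v 2)]) (by norm_num)
  have h0 := abs_le_of_sq_le_sq' (a := 2 * v 0 - v 2) (b := 2)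
    (by nlinarith [sq_nonneg (v 2), sq_nonneg (2 * v 1 - v 2),
      sq_nonneg (2 * v 3 - v 2)]) (by norm_num)
  have h1 := abs_le_of_sq_le_sq' (a := 2 * v 1 - v 2) (b := 2)
    (by nlinarith [sq_nonneg (v 2), sq_nonneg (2 * v 0 - v 2),
      sq_nonneg (2 * v 3 - v 2)]) (by norm_num)
  have h3 := abs_le_of_sq_le_sq' (a := 2 * v 3 - v 2) (b := 2)
    (by nlinarith [sq_nonneg (v 2), sq_nonneg (2 * v 0 - v 2),
      sq_nonneg (2 * v 1 - v 2)]) (by norm_num)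
  intro i _
  rw [Set.mem_Icc]
  fin_cases i <;> simp <;> omega

instance : Finite Root := finite_roots.to_subtype

/-! ### The Chevalley basis and the root elements -/

/-- The sign of a root: `1` if it is positive and `-1` if it is negative. -/
def rootSign (v : Fin 4 → ℤ) : ℤ := if ∀ i, 0 ≤ v i then 1 else -1

/-- An integral bilinear form on the root lattice with `cocycle v v ≡ form v v / 2` and
`cocycle v w + cocycle w v ≡ form v w` modulo `2`. -/
def cocycle (v w : Fin 4 → ℤ) : ℤ :=
  v 0 * w 0 + v 1 * w 1 + v 2 * w 2 + v 3 * w 3 +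
    v 2 * w 0 + v 2 * w 1 + v 3 * w 2 + v 0 * w 1 + v 1 * w 0

/-- The structure constants `N_{rs} = ± 1` of the Chevalley basis, `[e_r, e_s] = N_{rs} e_{r+s}`
whenever `r`, `s` and `r + s` are roots. -/
def structConst (r s : Fin 4 → ℤ) : ℤ :=
  rootSign r * rootSign s * rootSign (r + s) * ((cocycle r s).negOnePow : ℤˣ)

variable (R : Type*) [CommRing R]

/-- The Lie algebra of type `D₄` over `R`, as a module: the free module on the Chevalley basis
`h₁, …, h₄` and `e_r` (`r ∈ Φ`), where `h_i` is the coroot of `α_i`. A pair `v` is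
`∑ i, v.1 i • h_i + ∑ r, v.2 r • e_r`. -/
abbrev L : Type _ := (Fin 4 → R) × (Root → R)

variable {R}

/-- The linear map `ad e_r`. On the Chevalley basis:
`h_i ↦ - ⟨r, α_i⟩ e_r`, `e_{-r} ↦ h_r = ∑ i, r_i h_i`, `e_s ↦ N_{rs} e_{r+s}` if `r + s ∈ Φ`, and
`e_s ↦ 0` for the remaining roots `s`. -/
def adE (r : Root) : L R →ₗ[R] L R where
  toFun v :=
    (fun i => (r.1 i : R) * v.2 r.neg,
     fun s => if s = r then - ∑ i, (form r.1 (Pi.single i 1) : R) * v.1 i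
       else if h : s.1 - r.1 ∈ roots then
         (structConst r.1 (s.1 - r.1) : R) * v.2 ⟨s.1 - r.1, h⟩
       else 0)
  map_add' v w := by
    ext i
    · simp [mul_add]
    · simp only [Prod.fst_add, Prod.snd_add, Pi.add_apply, mul_add, Finset.sum_add_distrib]
      split_ifs <;> ring
  map_smul' c v := by
    ext i
    · simp [mul_left_comm]
    · simp only [Prod.smul_fst, Prod.smul_snd, Pi.smul_apply, smul_eq_mul, mul_left_comm _ c,
        ← Finset.mul_sum, RingHom.id_apply]
      split_ifs <;> ring

/-- The divided square `(ad e_r)² / 2`: it maps `e_{-r}` to `- e_r` and all other elements of the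
Chevalley basis to `0`. -/
def adEDivSq (r : Root) : L R →ₗ[R] L R where
  toFun v := (0, fun s => if s = r then - v.2 r.neg else 0)
  map_add' v w := by
    ext i
    · simp
    · simp only [Prod.snd_add, Pi.add_apply]
      split_ifs <;> ring
  map_smul' c v := by
    ext i
    · simp
    · simp only [Prod.smul_snd, Pi.smul_apply, smul_eq_mul, RingHom.id_apply]
      split_ifs <;> ring

theorem neg_ne (r : Root) : r.neg ≠ r := by
  intro h
  have h1 : form r.1 r.1 = 2 := r.2
  have h2 : -r.1 = r.1 := congrArg Subtype.val h
  have h3 : ∀ i, r.1 i = 0 := fun i => by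
    have := congrFun h2 i
    simp only [Pi.neg_apply] at this
    omega
  rw [form_self] at h1
  simp [h3] at h1

theorem neg_sub_notMem (r : Root) : r.neg.1 - r.1 ∉ roots := by
  intro h
  have h1 : form r.1 r.1 = 2 := r.2
  have h2 : form (r.neg.1 - r.1) (r.neg.1 - r.1) = 2 := h
  rw [form_self] at h1 h2
  simp only [Root.neg, Pi.sub_apply, Pi.neg_apply] at h2
  linarith

theorem sub_sub_notMem (r s : Root) (hs : s ≠ r) : s.1 - r.1 - r.1 ∉ roots := by
  intro h
  apply hs
  have hr : form r.1 r.1 = 2 := r.2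
  have hs' : form s.1 s.1 = 2 := s.2
  have h2 : form (s.1 - r.1 - r.1) (s.1 - r.1 - r.1) = 2 := h
  have h0 : form (s.1 - r.1) (s.1 - r.1) = 0 := by
    rw [form_self] at *
    simp only [Pi.sub_apply] at *
    linarith
  rw [form_self] at h0
  set w := s.1 - r.1 with hw
  have e : (2 * w 0 - w 2) ^ 2 + (2 * w 1 - w 2) ^ 2 + (2 * w 3 - w 2) ^ 2 + w 2 ^ 2 = 0 := by
    linarith
  have a2 : w 2 = 0 := by
    nlinarith [sq_nonneg (2 * w 0 - w 2), sq_nonneg (2 * w 1 - w 2), sq_nonneg (2 * w 3 - w 2),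
      sq_nonneg (w 2)]
  rw [a2] at e
  have a0 : w 0 = 0 := by nlinarith [sq_nonneg (w 0), sq_nonneg (w 1), sq_nonneg (w 3)]
  have a1 : w 1 = 0 := by nlinarith [sq_nonneg (w 0), sq_nonneg (w 1), sq_nonneg (w 3)]
  have a3 : w 3 = 0 := by nlinarith [sq_nonneg (w 0), sq_nonneg (w 1), sq_nonneg (w 3)]
  have w0 : w = 0 := by
    funext i
    fin_cases i <;> assumption
  exact Subtype.ext (sub_eq_zero.mp w0)

theorem sum_form_single (r : Root) :
    ∑ i, (form r.1 (Pi.single i 1) : R) * (r.1 i : R) = 2 := by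
  have h1 : form r.1 r.1 = 2 := r.2
  have h2 : ∑ i, form r.1 (Pi.single i 1) * r.1 i = 2 := by
    rw [← h1]
    simp [form, cartan, Fin.sum_univ_four]
    ring
  exact_mod_cast congrArg (Int.cast : ℤ → R) h2

theorem sub_ne (r s : Root) (h : s.1 - r.1 ∈ roots) : (⟨s.1 - r.1, h⟩ : Root) ≠ r := by
  intro e
  have e1 : s.1 - r.1 = r.1 := congrArg Subtype.val e
  have hr : form r.1 r.1 = 2 := r.2
  have hs : form s.1 s.1 = 2 := s.2
  rw [sub_eq_iff_eq_add.mp e1, form_self] at hs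
  rw [form_self] at hr
  simp only [Pi.add_apply] at hs
  linarith

theorem adE_adE (r : Root) (v : L R) : adE r (adE r v) = (2 : R) • adEDivSq r v := by
  refine Prod.ext (funext fun i => ?_) (funext fun s => ?_)
  · simp [adE, adEDivSq, neg_ne, neg_sub_notMem]
  · by_cases hs : s = r
    · simp only [adE, adEDivSq, LinearMap.coe_mk, AddHom.coe_mk, hs, if_true, Prod.smul_snd,
        Pi.smul_apply, smul_eq_mul]
      rw [← sum_form_single r, Finset.sum_mul, ← Finset.sum_neg_distrib]
      exact Finset.sum_congr rfl fun i _ => by ring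
    · by_cases h : s.1 - r.1 ∈ roots
      · simp [adE, adEDivSq, hs, h, sub_ne, sub_sub_notMem r s hs]
      · simp [adE, adEDivSq, hs, h]

theorem adE_adEDivSq (r : Root) (v : L R) : adE r (adEDivSq r v) = 0 := by
  refine Prod.ext (funext fun i => ?_) (funext fun s => ?_)
  · simp [adE, adEDivSq, neg_ne]
  · by_cases hs : s = r
    · simp [adE, adEDivSq, hs]
    · by_cases h : s.1 - r.1 ∈ roots
      · simp [adE, adEDivSq, sub_ne]
      · simp [adE, adEDivSq, hs, h]

theorem adEDivSq_adE (r : Root) (v : L R) : adEDivSq r (adE r v) = 0 := by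
  refine Prod.ext (funext fun i => ?_) (funext fun s => ?_)
  · simp [adEDivSq]
  · simp [adE, adEDivSq, neg_ne, neg_sub_notMem]

theorem adEDivSq_adEDivSq (r : Root) (v : L R) : adEDivSq r (adEDivSq r v) = 0 := by
  refine Prod.ext (funext fun i => ?_) (funext fun s => ?_)
  · simp [adEDivSq]
  · simp [adEDivSq, neg_ne]

/-- `exp (t ad e_r) = 1 + t ad e_r + t² (ad e_r)² / 2` as a linear map; the higher powers of
`ad e_r` vanish. -/
def expAdE (r : Root) (t : R) : L R →ₗ[R] L R :=
  LinearMap.id + t • adE r + t ^ 2 • adEDivSq r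

theorem expAdE_add (r : Root) (t u : R) (v : L R) :
    expAdE r t (expAdE r u v) = expAdE r (t + u) v := by
  simp only [expAdE, LinearMap.add_apply, LinearMap.smul_apply, LinearMap.id_apply, map_add,
    map_smul, adE_adE, adE_adEDivSq, adEDivSq_adE, adEDivSq_adEDivSq, smul_zero, add_zero]
  module

theorem expAdE_zero (v : L R) (r : Root) : expAdE r 0 v = v := by
  simp [expAdE]

/-- The root element `x_r(t) = exp (t ad e_r)`, an automorphism of the module `L R`. -/
def rootElt (r : Root) (t : R) : L R ≃ₗ[R] L R where
  __ := expAdE r t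
  invFun := expAdE r (-t)
  left_inv v := by
    change expAdE r (-t) (expAdE r t v) = v
    rw [expAdE_add, neg_add_cancel, expAdE_zero]
  right_inv v := by
    change expAdE r t (expAdE r (-t) v) = v
    rw [expAdE_add, add_neg_cancel, expAdE_zero]

/-! ### The Chevalley group and its maximal unipotent subgroup -/

variable (F : Type*) [Field F]

/-- The Chevalley group `G` of type `D₄` over `F`, generated by all root elements. -/
def chevalleyGroup : Subgroup (L F ≃ₗ[F] L F) :=
  Subgroup.closure {g | ∃ (r : Root) (t : F), g = rootElt r t}

/-- The subgroup `U` of `G`, generated by the root elements `x_α(t)` for `α ∈ Φ₊`. -/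
def U : Subgroup (L F ≃ₗ[F] L F) :=
  Subgroup.closure {g | ∃ (α : PosRoot) (t : F), g = rootElt α.toRoot t}

theorem U_le_chevalleyGroup : U F ≤ chevalleyGroup F :=
  Subgroup.closure_mono fun _ ⟨α, t, h⟩ => ⟨α.toRoot, t, h⟩

instance [Finite F] : Finite (U F) :=
  have : Finite (L F ≃ₗ[F] L F) := DFunLike.finite _
  inferInstance

variable {F}

/-- The root element `x_α(t)` for a positive root `α`, as an element of `U`. -/
def x (α : PosRoot) (t : F) : U F :=
  ⟨rootElt α.toRoot t, Subgroup.subset_closure ⟨α, t, rfl⟩⟩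

variable (F)

/-- The root subgroup `X_α = ⟨x_α(t) | t ∈ F⟩` for a positive root `α`. -/
def X (α : PosRoot) : Subgroup (U F) := Subgroup.closure (Set.range fun t : F => x α t)

/-! ### Hooks, arms, legs and the subgroups `V_α` -/

/-- The hook `h_α`: all `γ ∈ Φ₊` such that `γ + γ' = α` for some `γ' ∈ Φ₊ ∪ {0}`. -/
def hook (α : PosRoot) : Set PosRoot :=
  {γ | ∃ γ' : Fin 4 → ℤ, (γ' ∈ posRoots ∨ γ' = 0) ∧ γ.1 + γ' = α.1}

open scoped Classical in
/-- The arm of the hook `h_α`: the set `(h_α ∩ h_{α₁₂}) \ {α}` if `α ≠ α₁₂`, and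
`{α₈, α₉, α₁₀, α₁₁}` if `α = α₁₂`. -/
noncomputable def arm (α : PosRoot) : Set PosRoot :=
  if α = posRoot 11 then {posRoot 7, posRoot 8, posRoot 9, posRoot 10}
  else (hook α ∩ hook (posRoot 11)) \ {α}

/-- The leg of the hook `h_α`: the set `h_α \ (arm(h_α) ∪ {α})`. -/
noncomputable def leg (α : PosRoot) : Set PosRoot := hook α \ (arm α ∪ {α})

/-- The subgroup of `U` generated by the root subgroups `X_γ` for `γ ∈ Φ₊ \ leg(α)`. -/
noncomputable def V (α : PosRoot) : Subgroup (U F) := ⨆ γ ∈ (leg α)ᶜ, X F γ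

/-- The product set `∏ X_γ` over all `γ ∈ Φ₊ \ leg(α)`, the factors in the order of the numbering
`α₁, …, α₁₂`. -/
def prodSet (α : PosRoot) : Set (U F) :=
  {u | ∃ d : Fin 12 → F, (∀ i, posRoot i ∈ leg α → d i = 0) ∧
    u = (List.ofFn fun i => x (posRoot i) (d i)).prod}

variable {F}

/-- The conditions on the linear character `λ_{α,s}` of `V_α`: its restriction to `X_α` is
`φ_{α,s} : x_α(d) ↦ φ(s d)`, and `X_γ ⊆ ker(λ_{α,s})` for all positive roots `γ` with
`ht(γ) > ht(α)`. -/
def IsLambda (φ : AddChar F ℂ) (α : PosRoot) (s : F) (l : V F α →* ℂˣ) : Prop :=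
  (∀ d : F, ∃ h : x α d ∈ V F α, (l ⟨x α d, h⟩ : ℂ) = φ (s * d)) ∧
    ∀ γ : PosRoot, height α.1 < height γ.1 → X F γ ≤ l.ker.map (V F α).subtype

end D4

/-! ### Characters of finite groups -/

open scoped Classical in
/-- The class function of the finite group `G` induced from the function `χ` on the subgroup `H`:
`χ^G(g) = |H|⁻¹ ∑_{y ∈ G} χ°(y⁻¹ g y)`, where `χ°` is `χ` on `H` and `0` outside `H`. -/
noncomputable def inducedChar {G : Type*} [Group G] [Finite G] (H : Subgroup G) (χ : H → ℂ) :
    G → ℂ :=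
  fun g => (Nat.card H : ℂ)⁻¹ *
    ∑ᶠ y : G, if h : y⁻¹ * g * y ∈ H then χ ⟨y⁻¹ * g * y, h⟩ else 0

/-- `χ` is the character of an irreducible finite-dimensional complex representation of `G`. -/
def IsIrreducibleChar {G : Type*} [Group G] (χ : G → ℂ) : Prop :=
  ∃ W : FDRep ℂ G, CategoryTheory.Simple W ∧ W.character = χ

/-- The midafi `λ^U` of `U` defined by the linear character `λ` of `V_α`. -/
noncomputable def D4.midafi {F : Type*} [Field F] [Finite F] {α : D4.PosRoot}
    (l : D4.V F α →* ℂˣ) : D4.U F → ℂ :=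
  inducedChar (D4.V F α) fun v => (l v : ℂ)

/-! ### Characters induced from linear characters -/

/-! Irreducibility is Mackey's criterion for a linear character `l` of `H`: if every `w ∉ H` admits
`h ∈ H` with `w⁻¹ * h * w ∈ H` and `l h ≠ l (w⁻¹ * h * w)`, then the induced character has norm one
(`isIrreducibleChar_inducedChar`).

The commutator relations in `U` (`x_comm`, `x_mul_x`) come from the Lie algebra: a Jacobi identity
for the structure constants gives the commutators of the maps `ad e_r`, and these are exponentiated
over a domain of characteristic zero and then specialised to any ring. Hence, for suitably ordered
lists of roots, the generated subgroup consists of ordered products (`exists_prodList_eq`). This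
describes `V_α` and writes every element of `U` as a leg product times an element of `V_α`;
uniqueness of such factorisations is never needed.

The combinatorial core is the pairing of arm and leg. The complement of the leg is closed under
sums, and `α` is not a sum of two roots outside the leg. So `V_α` acts on the span of `e_{-α}` and
the coroot of `α`, modulo a stable subspace, by unipotent 2×2 matrices; their off-diagonal entry is
a homomorphism to `F` that is `t` on `x_α(t)` and vanishes on the other generators. Composing it
with `φ (s * ·)` gives `λ` (`exists_isLambda`). Conversely, if a leg product has a nonzero
coordinate at `α_i`, conjugating the arm element `x_j(u)`, where `α_j + α_i = α`, produces an extra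
factor in `X_α` on which `λ` takes a prescribed value of `φ`. This verifies Mackey's criterion
(`exists_ne_of_notMem`).

Finally `x_α(d)` is central modulo the root subgroups of larger height, which lie in the kernel of
`λ`. So the midafi at `x_α(d)` is its degree times `φ (s * d)` (`midafi_x`), and this value also
separates the parameters `s`. -/

open CategoryTheory in
theorem isIrreducibleChar_trace {G W : Type*} [Group G] [Fintype G] [AddCommGroup W] [Module ℂ W]
    [FiniteDimensional ℂ W] (ρ : Representation ℂ G W)
    (h : ∑ g : G, LinearMap.trace ℂ W (ρ g) * LinearMap.trace ℂ W (ρ g⁻¹) = Nat.card G) :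
    IsIrreducibleChar fun g => LinearMap.trace ℂ W (ρ g) := by
  -- The norm criterion is applied to a copy of the representation with both group and space in
  -- `Type`; simplicity returns along the equivalence of categories given by the group isomorphism.
  let e : W ≃ₗ[ℂ] (Fin (Module.finrank ℂ W) → ℂ) := (Module.finBasis ℂ W).equivFun
  have : Small.{0} G := Countable.toSmall G
  let m : Shrink.{0} G ≃* G := Shrink.mulEquiv
  let ρ' : Representation ℂ (Shrink.{0} G) (Fin (Module.finrank ℂ W) → ℂ) :=
    { toFun := fun g => e.conj (ρ (m g))
      map_one' := by ext; simp
      map_mul' := fun g g' => by ext; simp }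
  have hρ' (g) : LinearMap.trace ℂ _ (ρ' g) = LinearMap.trace ℂ W (ρ (m g)) :=
    LinearMap.trace_conj' (ρ (m g)) e
  have : Fintype (Shrink.{0} G) := Fintype.ofEquiv G m.symm.toEquiv
  have hs : Simple (FDRep.of ρ') := by
    rw [FDRep.simple_iff_char_is_norm_one, Nat.card_congr m.toEquiv, ← h,
      ← Equiv.sum_comp m.toEquiv]
    refine Finset.sum_congr rfl fun g _ => ?_
    have e1 := hρ' g
    have e2 := hρ' g⁻¹
    rw [map_inv m] at e2
    exact congrArg₂ (· * ·) e1 e2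
  let r := (Action.resEquiv (FGModuleCat ℂ) m.symm).functor
  have : r.IsEquivalence := inferInstance
  refine ⟨r.obj (FDRep.of ρ'), simple_obj r _, funext fun g => ?_⟩
  have e1 := hρ' (m.symm g)
  rw [MulEquiv.apply_symm_apply] at e1
  exact e1

section Induced

variable {G : Type*} [Group G] {H : Subgroup G} (l : H →* ℂˣ)

open scoped Classical in
/-- The extension by zero of a linear character of a subgroup. -/
noncomputable def extendChar (g : G) : ℂ := if h : g ∈ H then (l ⟨g, h⟩ : ℂ) else 0

theorem extendChar_coe (h : H) : extendChar l h = l h := by simp [extendChar]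

theorem extendChar_of_notMem {g : G} (h : g ∉ H) : extendChar l g = 0 := by simp [extendChar, h]

theorem extendChar_mul (h : H) (g : G) : extendChar l (h * g) = l h * extendChar l g := by
  by_cases hg : g ∈ H
  · lift g to H using hg
    rw [← Subgroup.coe_mul, extendChar_coe, extendChar_coe, map_mul, Units.val_mul]
  · rw [extendChar_of_notMem l hg, extendChar_of_notMem l, mul_zero]
    rwa [Subgroup.mul_mem_cancel_left H h.2]

theorem extendChar_mul_right (g : G) (h : H) : extendChar l (g * h) = extendChar l g * l h := by
  by_cases hg : g ∈ H
  · lift g to H using hg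
    rw [← Subgroup.coe_mul, extendChar_coe, extendChar_coe, map_mul, Units.val_mul]
  · rw [extendChar_of_notMem l hg, extendChar_of_notMem l, zero_mul]
    rwa [Subgroup.mul_mem_cancel_right H h.2]

theorem inducedChar_eq [Fintype G] (g : G) :
    inducedChar H (fun v => (l v : ℂ)) g =
      (Nat.card H : ℂ)⁻¹ * ∑ y : G, extendChar l (y⁻¹ * g * y) := by
  rw [inducedChar, finsum_eq_sum_of_fintype]
  rfl

/-- The space of functions `f` with `f (h g) = l h f g`. -/
def inducedSpace : Submodule ℂ (G → ℂ) where
  carrier := {f | ∀ (h : H) g, f (h * g) = l h * f g}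
  add_mem' hf hf' h g := by simp [hf h g, hf' h g, mul_add]
  zero_mem' h g := by simp
  smul_mem' c f hf h g := by simp [hf h g, mul_left_comm]

/-- The right regular representation on functions. -/
def rightTranslation : Representation ℂ G (G → ℂ) where
  toFun g := LinearMap.funLeft ℂ ℂ (· * g)
  map_one' := by ext; simp
  map_mul' g g' := by
    refine LinearMap.ext fun f => funext fun x => ?_
    simp [mul_assoc]

/-- The representation induced from a linear character. -/
def inducedRep : Representation ℂ G (inducedSpace l) where
  toFun g := (rightTranslation g).restrict fun f hf h x => by
    change f (h * x * g) = _ * f (x * g)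
    rw [mul_assoc, hf h]
  map_one' := by ext; simp
  map_mul' g g' := LinearMap.ext fun f => Subtype.ext (congrArg (· f.1) (map_mul rightTranslation g g'))

variable [Fintype G]

/-- The projection onto the space of the induced representation. -/
noncomputable def inducedProj : (G → ℂ) →ₗ[ℂ] inducedSpace l where
  toFun f := ⟨fun x : G => (Nat.card H : ℂ)⁻¹ * ∑ y : G, extendChar l y⁻¹ * f (y * x), fun h x => by
    change (Nat.card H : ℂ)⁻¹ * ∑ y : G, extendChar l y⁻¹ * f (y * (h * x)) =
      (l h : ℂ) * ((Nat.card H : ℂ)⁻¹ * ∑ y : G, extendChar l y⁻¹ * f (y * x))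
    rw [mul_left_comm, ← Equiv.sum_comp (Equiv.mulRight h⁻¹.1), Finset.mul_sum _ _ (l h : ℂ)]
    refine congrArg ((Nat.card H : ℂ)⁻¹ * ·) (Finset.sum_congr rfl fun y _ => ?_)
    simp only [Equiv.coe_mulRight, mul_inv_rev, inv_inv, Subgroup.coe_inv]
    rw [extendChar_mul, mul_assoc, mul_assoc, inv_mul_cancel_left]⟩
  map_add' f f' := by
    ext x
    simp [mul_add, Finset.sum_add_distrib]
  map_smul' c f := by
    ext x
    simp [Finset.mul_sum, mul_left_comm]

open scoped Classical in
theorem inducedProj_comp_subtype : inducedProj l ∘ₗ (inducedSpace l).subtype = LinearMap.id := by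
  refine LinearMap.ext fun f => Subtype.ext (funext fun x => ?_)
  have e : ∑ y, extendChar l y⁻¹ * f.1 (y * x) = ∑ y : G, if y ∈ H then f.1 x else 0 := by
    refine Finset.sum_congr rfl fun y _ => ?_
    split_ifs with hy
    · lift y to H using hy
      rw [f.2 y, ← Subgroup.coe_inv, extendChar_coe, map_inv, ← mul_assoc, Units.inv_mul, one_mul]
    · rw [extendChar_of_notMem, zero_mul]
      rwa [inv_mem_iff]
  change (Nat.card H : ℂ)⁻¹ * ∑ y, extendChar l y⁻¹ * f.1 (y * x) = f.1 x
  have hc : (Nat.card H : ℂ) ≠ 0 := Nat.cast_ne_zero.2 Nat.card_pos.ne'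
  rw [e, ← Finset.sum_filter, Finset.sum_const, nsmul_eq_mul, ← Fintype.card_subtype,
    ← Nat.card_eq_fintype_card]
  exact inv_mul_cancel_left₀ hc _

/-- The induced space is a retract of `G → ℂ`, so by cyclicity the trace becomes that of an operator
on all functions, read off in the basis of delta functions. -/
theorem trace_inducedRep (g : G) :
    LinearMap.trace ℂ _ (inducedRep l g) = inducedChar H (fun v => (l v : ℂ)) g := by
  classical
  have e1 : inducedRep l g =
      inducedProj l ∘ₗ (rightTranslation g ∘ₗ (inducedSpace l).subtype) := by
    have : rightTranslation g ∘ₗ (inducedSpace l).subtype =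
      (inducedSpace l).subtype ∘ₗ inducedRep l g := rfl
    rw [this, ← LinearMap.comp_assoc, inducedProj_comp_subtype, LinearMap.id_comp]
  rw [e1, LinearMap.trace_comp_comm', inducedChar_eq, LinearMap.trace_eq_matrix_trace ℂ
    (Pi.basisFun ℂ G), Matrix.trace, Finset.mul_sum, ← Equiv.sum_comp (Equiv.inv G)]
  refine Finset.sum_congr rfl fun x _ => ?_
  simp only [Matrix.diag_apply, LinearMap.toMatrix_apply, Pi.basisFun_apply, Pi.basisFun_repr]
  change (Nat.card H : ℂ)⁻¹ * ∑ y, extendChar l y⁻¹ * (Pi.single x⁻¹ 1 : G → ℂ) (y * (x⁻¹ * g)) = _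
  -- The delta function at `x⁻¹` is nonzero at `y * (x⁻¹ * g)` only for this `y`, and `y⁻¹ = x⁻¹ * g
  -- * x` is the argument in the formula for the induced character.
  rw [Finset.sum_eq_single (x⁻¹ * g⁻¹ * x)]
  · rw [show x⁻¹ * g⁻¹ * x * (x⁻¹ * g) = x⁻¹ by group, Pi.single_eq_same, mul_one]
    congr 2
    group
  · intro y _ hy
    rw [Pi.single_eq_of_ne, mul_zero]
    intro h
    apply hy
    rw [eq_mul_inv_of_mul_eq h]
    group
  · simp

-- For `w ∈ H` the summand is 1 on `H`, since `l` is invariant under conjugation in `H`. For `w ∉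
-- H`, translating the summation variable by the element from `hw` multiplies the sum by a scalar
-- different from 1, so the sum vanishes.
open scoped Classical in
theorem sum_extendChar_mul (w : G)
    (hw : w ∉ H → ∃ (h : H) (h' : w⁻¹ * h * w ∈ H), l h ≠ l ⟨_, h'⟩) :
    ∑ h : G, extendChar l h * extendChar l (w⁻¹ * h⁻¹ * w) =
      if w ∈ H then (Nat.card H : ℂ) else 0 := by
  split_ifs with hwH
  · lift w to H using hwH
    have e : ∀ h : G, extendChar l h * extendChar l ((w : G)⁻¹ * h⁻¹ * w) =
        if h ∈ H then 1 else 0 := by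
      intro h
      split_ifs with hh
      · lift h to H using hh
        rw [← Subgroup.coe_inv, ← Subgroup.coe_inv, ← Subgroup.coe_mul, ← Subgroup.coe_mul,
          extendChar_coe, extendChar_coe, ← Units.val_mul, ← map_mul, Units.val_eq_one]
        simp only [map_mul, map_inv]
        rw [mul_comm (l w)⁻¹, inv_mul_cancel_right, mul_inv_cancel]
      · rw [extendChar_of_notMem l hh, zero_mul]
    rw [Finset.sum_congr rfl fun h _ => e h, ← Finset.sum_filter, Finset.sum_const, nsmul_eq_mul,
      mul_one, ← Fintype.card_subtype, ← Nat.card_eq_fintype_card]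
  · obtain ⟨a, ha, hne⟩ := hw hwH
    set S := ∑ h : G, extendChar l h * extendChar l (w⁻¹ * h⁻¹ * w) with hS
    have key : S = (l a * (l ⟨_, ha⟩)⁻¹ : ℂˣ) * S := by
      conv_lhs => rw [hS, ← Equiv.sum_comp (Equiv.mulLeft (a : G))]
      rw [hS, Finset.mul_sum]
      refine Finset.sum_congr rfl fun h _ => ?_
      rw [Equiv.coe_mulLeft, extendChar_mul,
        show w⁻¹ * (a * h)⁻¹ * w = w⁻¹ * h⁻¹ * w * ((⟨_, ha⟩⁻¹ : H) : G) by
          simp only [Subgroup.coe_inv]; group, extendChar_mul_right, map_inv, Units.val_mul]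
      ring
    by_contra hS0
    have h1 : ((l a * (l ⟨_, ha⟩)⁻¹ : ℂˣ) : ℂ) = 1 := mul_right_cancel₀ hS0 (by rw [← key, one_mul])
    rw [Units.val_eq_one, mul_inv_eq_one] at h1
    exact hne h1

theorem sum_inducedChar_mul_inv
    (hw : ∀ w ∉ H, ∃ (h : H) (h' : w⁻¹ * h * w ∈ H), l h ≠ l ⟨_, h'⟩) :
    ∑ g : G, inducedChar H (fun v => (l v : ℂ)) g * inducedChar H (fun v => (l v : ℂ)) g⁻¹ =
      Nat.card G := by
  classical
  have hc : (Nat.card H : ℂ) ≠ 0 := Nat.cast_ne_zero.2 Nat.card_pos.ne'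
  have e (y : G) : ∑ g : G, ∑ z : G, extendChar l (y⁻¹ * g * y) * extendChar l (z⁻¹ * g⁻¹ * z) =
      Nat.card H * Nat.card H := by
    -- Substituting `g = y * h * y⁻¹` and `z = y * w` turns the inner sum into the one of
    -- `sum_extendChar_mul`, which depends on `w` alone.
    rw [← Equiv.sum_comp (MulAut.conj y).toEquiv, Finset.sum_comm,
      ← Equiv.sum_comp (Equiv.mulLeft y)]
    have e2 (w : G) : ∑ h : G, extendChar l (y⁻¹ * (MulAut.conj y) h * y) *
        extendChar l ((y * w)⁻¹ * ((MulAut.conj y) h)⁻¹ * (y * w)) =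
        if w ∈ H then (Nat.card H : ℂ) else 0 := by
      rw [← sum_extendChar_mul l w (hw w)]
      refine Finset.sum_congr rfl fun h _ => ?_
      congr 2
      · simp [mul_assoc]
      · simp [mul_assoc]
    refine (Finset.sum_congr rfl fun w _ => e2 w).trans ?_
    rw [← Finset.sum_filter, Finset.sum_const, nsmul_eq_mul, ← Fintype.card_subtype,
      ← Nat.card_eq_fintype_card]
  simp only [inducedChar_eq]
  have e3 (g : G) : (Nat.card H : ℂ)⁻¹ * (∑ y : G, extendChar l (y⁻¹ * g * y)) *
      ((Nat.card H : ℂ)⁻¹ * ∑ y : G, extendChar l (y⁻¹ * g⁻¹ * y)) =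
      (Nat.card H : ℂ)⁻¹ * (Nat.card H : ℂ)⁻¹ *
        ∑ y : G, ∑ z : G, extendChar l (y⁻¹ * g * y) * extendChar l (z⁻¹ * g⁻¹ * z) := by
    rw [← Finset.sum_mul_sum]
    ring
  rw [Finset.sum_congr rfl fun g _ => e3 g, ← Finset.mul_sum, Finset.sum_comm,
    Finset.sum_congr rfl fun y _ => e y, Finset.sum_const, Finset.card_univ, nsmul_eq_mul,
    ← Nat.card_eq_fintype_card]
  field_simp

theorem isIrreducibleChar_inducedChar
    (hw : ∀ w ∉ H, ∃ (h : H) (h' : w⁻¹ * h * w ∈ H), l h ≠ l ⟨_, h'⟩) :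
    IsIrreducibleChar (inducedChar H fun v => (l v : ℂ)) := by
  have := isIrreducibleChar_trace (inducedRep l)
    (by simpa only [trace_inducedRep] using sum_inducedChar_mul_inv l hw)
  simpa only [trace_inducedRep] using this

end Induced

namespace D4

/-! ### Inner products and signs of roots -/

theorem form_comm (v w : Fin 4 → ℤ) : form v w = form w v := by
  simp [form, cartan, Fin.sum_univ_four]
  ring

theorem form_add_left (u v w : Fin 4 → ℤ) : form (u + v) w = form u w + form v w := by
  simp [form, cartan, Fin.sum_univ_four]
  ring

theorem form_add_right (u v w : Fin 4 → ℤ) : form u (v + w) = form u v + form u w := by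
  simp [form, cartan, Fin.sum_univ_four]
  ring

theorem form_neg_right (v w : Fin 4 → ℤ) : form v (-w) = -form v w := by
  simp [form, cartan, Fin.sum_univ_four]
  ring

theorem form_add_self (v w : Fin 4 → ℤ) :
    form (v + w) (v + w) = form v v + 2 * form v w + form w w := by
  rw [form_add_left, form_add_right, form_add_right, form_comm w v]
  ring

theorem eq_zero_of_form_nonpos {v : Fin 4 → ℤ} (h : form v v ≤ 0) : v = 0 := by
  rw [form_self] at h
  have e : (2 * v 0 - v 2) ^ 2 + (2 * v 1 - v 2) ^ 2 + (2 * v 3 - v 2) ^ 2 + v 2 ^ 2 ≤ 0 := by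
    linarith
  have h0 := sq_nonneg (2 * v 0 - v 2)
  have h1 := sq_nonneg (2 * v 1 - v 2)
  have h3 := sq_nonneg (2 * v 3 - v 2)
  have h2 := sq_nonneg (v 2)
  have a2 : v 2 = 0 := pow_eq_zero_iff two_ne_zero |>.1 (by linarith)
  have a0 : 2 * v 0 - v 2 = 0 := pow_eq_zero_iff two_ne_zero |>.1 (by linarith)
  have a1 : 2 * v 1 - v 2 = 0 := pow_eq_zero_iff two_ne_zero |>.1 (by linarith)
  have a3 : 2 * v 3 - v 2 = 0 := pow_eq_zero_iff two_ne_zero |>.1 (by linarith)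
  funext i
  fin_cases i <;> simp <;> omega

theorem mem_roots_iff {v : Fin 4 → ℤ} : v ∈ roots ↔ form v v = 2 := Iff.rfl

theorem add_mem_roots_iff {r s : Fin 4 → ℤ} (hr : r ∈ roots) (hs : s ∈ roots) :
    r + s ∈ roots ↔ form r s = -1 := by
  rw [mem_roots_iff] at *
  rw [form_add_self]
  omega

theorem neg_one_le_form {r s : Fin 4 → ℤ} (hr : r ∈ roots) (hs : s ∈ roots) (h : r + s ≠ 0) :
    -1 ≤ form r s := by
  by_contra hlt
  apply h
  apply eq_zero_of_form_nonpos
  rw [mem_roots_iff] at *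
  rw [form_add_self]
  omega

theorem form_le_one {r s : Fin 4 → ℤ} (hr : r ∈ roots) (hs : s ∈ roots) (h : r ≠ s) :
    form r s ≤ 1 := by
  have := neg_one_le_form hr (neg_mem_roots hs) (by rwa [← sub_eq_add_neg, sub_ne_zero])
  rw [form_neg_right] at this
  omega

theorem bound_of_mem_roots {v : Fin 4 → ℤ} (hv : v ∈ roots) (i : Fin 4) : -2 ≤ v i ∧ v i ≤ 2 := by
  rw [mem_roots_iff, form_self] at hv
  have e : (2 * v 0 - v 2) ^ 2 + (2 * v 1 - v 2) ^ 2 + (2 * v 3 - v 2) ^ 2 + v 2 ^ 2 = 4 := by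
    linarith
  have h0 := sq_nonneg (2 * v 0 - v 2)
  have h1 := sq_nonneg (2 * v 1 - v 2)
  have h3 := sq_nonneg (2 * v 3 - v 2)
  have h2 := sq_nonneg (v 2)
  have a2 := abs_le_of_sq_le_sq' (a := v 2) (b := 2) (by linarith) (by norm_num)
  have a0 := abs_le_of_sq_le_sq' (a := 2 * v 0 - v 2) (b := 2) (by linarith) (by norm_num)
  have a1 := abs_le_of_sq_le_sq' (a := 2 * v 1 - v 2) (b := 2) (by linarith) (by norm_num)
  have a3 := abs_le_of_sq_le_sq' (a := 2 * v 3 - v 2) (b := 2) (by linarith) (by norm_num)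
  fin_cases i <;> simp <;> omega

theorem exists_eq_sub_two {a : ℤ} (h : -2 ≤ a ∧ a ≤ 2) : ∃ b : Fin 5, a = b - 2 :=
  ⟨⟨(a + 2).toNat, by omega⟩, by simp; omega⟩

/-- Bounded coordinates turn statements about all roots into finite checks over `Fin 5`, within
reach of `decide`. -/
theorem vec_eq_fin_sub_two {v : Fin 4 → ℤ} (hv : v ∈ roots) :
    ∃ a b c d : Fin 5, v = ![(a - 2 : ℤ), b - 2, c - 2, d - 2] := by
  obtain ⟨a, ha⟩ := exists_eq_sub_two (bound_of_mem_roots hv 0)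
  obtain ⟨b, hb⟩ := exists_eq_sub_two (bound_of_mem_roots hv 1)
  obtain ⟨c, hc⟩ := exists_eq_sub_two (bound_of_mem_roots hv 2)
  obtain ⟨d, hd⟩ := exists_eq_sub_two (bound_of_mem_roots hv 3)
  refine ⟨a, b, c, d, funext fun i => ?_⟩
  fin_cases i <;> assumption

theorem rootSign_neg {r : Fin 4 → ℤ} (hr : r ∈ roots) : rootSign (-r) = -rootSign r := by
  obtain ⟨a, b, c, d, rfl⟩ := vec_eq_fin_sub_two hr
  revert a b c d
  decide +kernel

theorem exists_rootVec_eq {v : Fin 4 → ℤ} (hv : v ∈ posRoots) : ∃ i, rootVec i = v := by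
  obtain ⟨a, b, c, d, rfl⟩ := vec_eq_fin_sub_two hv.1
  obtain ⟨h1, h2⟩ := hv
  revert a b c d
  decide +kernel

theorem rootSign_mul_self (r : Fin 4 → ℤ) : rootSign r * rootSign r = 1 := by
  unfold rootSign
  split_ifs <;> rfl

/-- `(-1) ^ n` as an integer. -/
def sgn (n : ℤ) : ℤ := (n.negOnePow : ℤˣ)

theorem sgn_add (m n : ℤ) : sgn (m + n) = sgn m * sgn n := by simp [sgn, Int.negOnePow_add]

theorem sgn_neg (m : ℤ) : sgn (-m) = sgn m := by simp [sgn]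

theorem sgn_zero : sgn 0 = 1 := by simp [sgn]

theorem sgn_one : sgn 1 = -1 := by simp [sgn]

theorem sgn_mul_self (m : ℤ) : sgn m * sgn m = 1 := by
  rw [← sgn_add, sgn, Int.negOnePow_even _ ⟨m, rfl⟩, Units.val_one]

theorem sgn_two_mul (m : ℤ) : sgn (2 * m) = 1 := by rw [two_mul, sgn_add, sgn_mul_self]

/-! ### Identities for the structure constants -/

theorem structConst_eq (r s : Fin 4 → ℤ) :
    structConst r s = rootSign r * rootSign s * rootSign (r + s) * sgn (cocycle r s) := rfl

theorem cocycle_add_left (u v w : Fin 4 → ℤ) :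
    cocycle (u + v) w = cocycle u w + cocycle v w := by
  simp only [cocycle, Pi.add_apply]
  ring

theorem cocycle_add_right (u v w : Fin 4 → ℤ) :
    cocycle u (v + w) = cocycle u v + cocycle u w := by
  simp only [cocycle, Pi.add_apply]
  ring

theorem cocycle_neg_right (v w : Fin 4 → ℤ) : cocycle v (-w) = -cocycle v w := by
  simp only [cocycle, Pi.neg_apply]
  ring

theorem sgn_cocycle_comm (v w : Fin 4 → ℤ) :
    sgn (cocycle w v) = sgn (form v w) * sgn (cocycle v w) := by
  have : cocycle w v = form v w + cocycle v w + 2 * (v 0 * w 2 + v 1 * w 2 + v 2 * w 3 -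
      (v 0 * w 0 + v 1 * w 1 + v 2 * w 2 + v 3 * w 3)) := by
    simp [form, cartan, cocycle, Fin.sum_univ_four]
    ring
  rw [this, sgn_add, sgn_add, sgn_two_mul, mul_one]

theorem sgn_cocycle_self {r : Fin 4 → ℤ} (hr : r ∈ roots) : sgn (cocycle r r) = -1 := by
  rw [mem_roots_iff, form_self] at hr
  have : cocycle r r = 1 + 2 * (r 2 * (r 0 + r 1 + r 3) + r 0 * r 1) := by
    simp only [cocycle]
    linarith
  rw [this, sgn_add, sgn_two_mul, sgn_one, mul_one]

theorem structConst_mul_structConst (r s q : Fin 4 → ℤ) :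
    structConst r s * structConst (r + s) q =
      rootSign r * rootSign s * rootSign q * rootSign (r + s + q) *
        sgn (cocycle r s + cocycle r q + cocycle s q) := by
  rw [structConst_eq, structConst_eq, cocycle_add_left, add_assoc (cocycle r s), sgn_add,
    sgn_add (cocycle r s), sgn_add]
  linear_combination (rootSign r * rootSign s * rootSign q * rootSign (r + s + q) *
    sgn (cocycle r s) * sgn (cocycle r q) * sgn (cocycle s q)) * rootSign_mul_self (r + s)

/-- Associativity of a 2-cocycle: the cocycle is bilinear, and the sign of the intermediate sum
occurs twice on either side and cancels. Membership in the root system plays no role. -/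
theorem structConst_mul_structConst' (r s q : Fin 4 → ℤ) :
    structConst r (s + q) * structConst s q = structConst r s * structConst (r + s) q := by
  rw [structConst_mul_structConst, structConst_eq, structConst_eq, cocycle_add_right, ← add_assoc r,
    sgn_add, sgn_add, sgn_add]
  linear_combination (rootSign r * rootSign s * rootSign q * rootSign (r + s + q) *
    sgn (cocycle r s) * sgn (cocycle r q) * sgn (cocycle s q)) * rootSign_mul_self (s + q)

theorem structConst_comm (r s : Fin 4 → ℤ) :
    structConst s r = sgn (form r s) * structConst r s := by
  rw [structConst_eq, structConst_eq, sgn_cocycle_comm, add_comm]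
  ring

theorem structConst_comm_of_add_mem {r s : Fin 4 → ℤ} (hr : r ∈ roots) (hs : s ∈ roots)
    (h : r + s ∈ roots) : structConst s r = -structConst r s := by
  rw [structConst_comm, (add_mem_roots_iff hr hs).1 h, sgn_neg, sgn_one, neg_one_mul]

theorem structConst_mul_self (r s : Fin 4 → ℤ) : structConst r s * structConst r s = 1 := by
  rw [structConst_eq]
  set d := sgn (cocycle r s)
  set c := rootSign (r + s)
  linear_combination (rootSign s * rootSign s * c * c * d * d) * rootSign_mul_self r +
    (c * c * d * d) * rootSign_mul_self s + (d * d) * rootSign_mul_self (r + s) +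
    sgn_mul_self (cocycle r s)

theorem structConst_mul_neg (r : Fin 4 → ℤ) {s : Fin 4 → ℤ} (hs : s ∈ roots) :
    structConst r s * structConst (r + s) (-s) = 1 := by
  rw [structConst_mul_structConst, rootSign_neg hs, add_neg_cancel_right, cocycle_neg_right,
    cocycle_neg_right, add_neg_cancel, zero_add, sgn_neg, sgn_cocycle_self hs]
  linear_combination (rootSign s * rootSign s) * rootSign_mul_self r + rootSign_mul_self s

theorem structConst_neg_add {r s : Fin 4 → ℤ} (hr : r ∈ roots) (hs : s ∈ roots)
    (h : r + s ∈ roots) : structConst s (-(r + s)) = structConst r s := by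
  have e : s + -(r + s) = -r := by abel
  rw [structConst_eq, structConst_eq, e, rootSign_neg h, rootSign_neg hr, cocycle_neg_right, sgn_neg,
    cocycle_add_right, sgn_add, sgn_cocycle_self hs, sgn_cocycle_comm,
    (add_mem_roots_iff hr hs).1 h, sgn_neg, sgn_one]
  ring

/-- The Jacobi identity for the structure constants. -/
theorem structConst_jacobi {r s q : Fin 4 → ℤ} (hr : r ∈ roots) (hs : s ∈ roots) (hq : q ∈ roots)
    (hp : r + s + q ∈ roots) (hrs : r + s ≠ 0) (hrq : r + q ≠ 0) (hsq : s + q ≠ 0) :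
    (if s + q ∈ roots then structConst r (s + q) * structConst s q else 0) -
      (if r + q ∈ roots then structConst s (r + q) * structConst r q else 0) =
      if r + s ∈ roots then structConst r s * structConst (r + s) q else 0 := by
  have e : structConst s (r + q) * structConst r q =
      sgn (form r s) * (structConst r s * structConst (r + s) q) := by
    rw [structConst_mul_structConst', structConst_comm, add_comm s r, mul_assoc]
  rw [structConst_mul_structConst', e]
  simp only [add_mem_roots_iff hr hs, add_mem_roots_iff hr hq, add_mem_roots_iff hs hq]
  have h1 := neg_one_le_form hr hs hrs
  have h2 := neg_one_le_form hr hq hrq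
  have h3 := neg_one_le_form hs hq hsq
  -- All four vectors have squared length 2. As each product is at least -1, exactly two of them are
  -- -1 and the third is 0. Hence exactly two of the three Jacobi terms survive, and they agree up
  -- to the sign in `e`.
  have h4 : form r s + form r q + form s q = -2 := by
    rw [mem_roots_iff] at *
    rw [form_add_self, form_add_self, form_add_left] at hp
    omega
  obtain h | h : form r s = -1 ∨ form r s ≠ -1 := eq_or_ne _ _
  · have : ¬ (form s q = -1 ∧ form r q = -1) ∧ (form s q = -1 ∨ form r q = -1) := by
      constructor <;> omega
    rw [h, sgn_neg, sgn_one]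
    split_ifs <;> first | ring1 | (exfalso; tauto)
  · have h5 : form r s = 0 ∧ form r q = -1 ∧ form s q = -1 := by omega
    simp [h5, sgn_zero]

theorem Root.ne_zero (r : Root) : r.1 ≠ 0 := by
  intro h
  have h2 : form r.1 r.1 = 2 := r.2
  rw [h] at h2
  simp [form] at h2

/-! ### Commutators of the maps `ad e_r` -/

variable {R : Type*} [CommRing R]

/-- The coefficient of `e_w`, extended by zero to all vectors `w`. -/
def coord (v : L R) (w : Fin 4 → ℤ) : R := if h : w ∈ roots then v.2 ⟨w, h⟩ else 0

theorem coord_root (v : L R) (r : Root) : coord v r.1 = v.2 r := by simp [coord]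

theorem coord_of_notMem (v : L R) {w : Fin 4 → ℤ} (h : w ∉ roots) : coord v w = 0 := by
  simp [coord, h]

theorem coord_adE_self (r : Root) (v : L R) :
    coord (adE r v) r.1 = -∑ i, (form r.1 (Pi.single i 1) : R) * v.1 i := by
  simp [coord_root, adE]

theorem coord_adE (r : Root) (v : L R) {w : Fin 4 → ℤ} (hw : w ∈ roots) (h : w ≠ r.1) :
    coord (adE r v) w = structConst r.1 (w - r.1) * coord v (w - r.1) := by
  have h' : (⟨w, hw⟩ : Root) ≠ r := fun e => h (congrArg Subtype.val e)
  simp only [coord, hw, adE, LinearMap.coe_mk, AddHom.coe_mk, h', if_false, dite_true]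
  split_ifs <;> simp

theorem adE_fst (r : Root) (v : L R) (i : Fin 4) : (adE r v).1 i = r.1 i * coord v (-r.1) :=
  congrArg (_ * ·) (coord_root v r.neg).symm

theorem adE_ext {v w : L R} (h1 : ∀ i, v.1 i = w.1 i) (h2 : ∀ p ∈ roots, coord v p = coord w p) :
    v = w :=
  Prod.ext (funext h1) (funext fun p => by rw [← coord_root, ← coord_root]; exact h2 p.1 p.2)

theorem coord_sub (v w : L R) (p : Fin 4 → ℤ) : coord (v - w) p = coord v p - coord w p := by
  unfold coord
  split_ifs <;> simp

theorem coord_smul (c : R) (v : L R) (p : Fin 4 → ℤ) : coord (c • v) p = c * coord v p := by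
  unfold coord
  split_ifs <;> simp

theorem sum_form_mul_adE_fst (r s : Root) (v : L R) :
    ∑ i, (form r.1 (Pi.single i 1) : R) * (adE s v).1 i = form r.1 s.1 * coord v (-s.1) := by
  simp only [adE_fst, ← mul_assoc, ← Finset.sum_mul]
  congr 1
  have h2 : ∑ i, form r.1 (Pi.single i 1) * s.1 i = form r.1 s.1 := by
    simp [form, cartan, Fin.sum_univ_four]
    ring
  exact_mod_cast congrArg (Int.cast : ℤ → R) h2

/-- From `e_{-s}` one reaches `e_r` in two ways: through the coroot of `s`, with factor `-(r, s)`,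
or through `e_{r-s}`, with factor -1 when `(r, s) = 1`. The difference vanishes for `(r, s) = 0, 1`
and is 1 for `(r, s) = -1`. -/
theorem coord_adE_adE_self {r s : Root} (h : r ≠ s) (v : L R) (hrs : r.1 + s.1 ≠ 0) :
    coord (adE r (adE s v)) r.1 - coord (adE s (adE r v)) r.1 =
      (if r.1 + s.1 ∈ roots then (1 : R) else 0) * coord v (-s.1) := by
  have hne : r.1 ≠ s.1 := fun e => h (Subtype.ext e)
  have h1 := neg_one_le_form r.2 s.2 hrs
  have h2 := form_le_one r.2 s.2 hne
  have hm : r.1 - s.1 ∈ roots ↔ form r.1 s.1 = 1 := by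
    rw [sub_eq_add_neg, add_mem_roots_iff r.2 (neg_mem_roots s.2), form_neg_right]
    omega
  rw [coord_adE_self, sum_form_mul_adE_fst, coord_adE s _ r.2 hne]
  simp only [add_mem_roots_iff r.2 s.2]
  by_cases hd : r.1 - s.1 ∈ roots
  · have hf := hm.1 hd
    rw [coord_adE r _ hd (by simpa using s.ne_zero), show r.1 - s.1 - r.1 = -s.1 by abel, hf,
      if_neg (by decide)]
    have e1 := structConst_mul_structConst' s.1 r.1 (-s.1)
    rw [structConst_comm r.1, mul_assoc, add_comm s.1, structConst_mul_neg _ s.2, hf, sgn_one,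
      ← sub_eq_add_neg] at e1
    have e2 : (structConst s.1 (r.1 - s.1) : R) * structConst r.1 (-s.1) = -1 := by
      exact_mod_cast congrArg (Int.cast : ℤ → R) e1
    push_cast
    linear_combination (-coord v (-s.1)) * e2
  · rw [coord_of_notMem _ hd]
    have hf : form r.1 s.1 ≠ 1 := fun e => hd (hm.2 e)
    split_ifs with h3
    · rw [h3]
      simp
    · rw [show form r.1 s.1 = 0 by omega]
      simp

/-- The commutator relation `[ad e_r, ad e_s] = ad [e_r, e_s]` for `r + s ≠ 0`. -/
theorem coord_adE_adE (r s : Root) (v : L R) (hrs : r.1 + s.1 ≠ 0) {p : Fin 4 → ℤ} (hp : p ∈ roots)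
    (hr : p ≠ r.1) (hs : p ≠ s.1) (hn : p ≠ r.1 + s.1) :
    coord (adE r (adE s v)) p - coord (adE s (adE r v)) p =
      (if r.1 + s.1 ∈ roots then (structConst r.1 s.1 * structConst (r.1 + s.1) (p - (r.1 + s.1)) : R)
        else 0) * coord v (p - (r.1 + s.1)) := by
  obtain ⟨q, rfl⟩ : ∃ q, p = r.1 + s.1 + q := ⟨p - (r.1 + s.1), by abel⟩
  rw [coord_adE r _ hp hr, coord_adE s _ hp hs, show r.1 + s.1 + q - r.1 = s.1 + q by abel,
    show r.1 + s.1 + q - s.1 = r.1 + q by abel, add_sub_cancel_left]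
  have hsq : s.1 + q ≠ 0 := fun e => hr (by rw [add_assoc, e, add_zero])
  have hrq : r.1 + q ≠ 0 := fun e => hs (by rw [add_right_comm, e, zero_add])
  have hq0 : q ≠ 0 := fun e => hn (by rw [e, add_zero])
  have e1 : coord (adE s v) (s.1 + q) =
      (if s.1 + q ∈ roots then (structConst s.1 q : R) else 0) * coord v q := by
    split_ifs with h
    · rw [coord_adE s _ h (by simpa using hq0), add_sub_cancel_left]
    · rw [coord_of_notMem _ h, zero_mul]
  have e2 : coord (adE r v) (r.1 + q) =
      (if r.1 + q ∈ roots then (structConst r.1 q : R) else 0) * coord v q := by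
    split_ifs with h
    · rw [coord_adE r _ h (by simpa using hq0), add_sub_cancel_left]
    · rw [coord_of_notMem _ h, zero_mul]
  rw [e1, e2]
  by_cases hq : q ∈ roots
  · have := congrArg (Int.cast : ℤ → R) (structConst_jacobi r.2 s.2 hq hp hrs hrq hsq)
    push_cast at this
    rw [← this]
    split_ifs <;> ring
  · simp [coord_of_notMem v hq]

theorem adE_fst_adE (r s : Root) (v : L R) (hrs : r.1 + s.1 ≠ 0) (i : Fin 4) :
    (adE r (adE s v)).1 i = r.1 i * ((if r.1 + s.1 ∈ roots then (structConst r.1 s.1 : R) else 0) *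
      coord v (-(r.1 + s.1))) := by
  rw [adE_fst, coord_adE s _ (neg_mem_roots r.2) fun e => hrs (by rw [← e, add_neg_cancel]),
    show -r.1 - s.1 = -(r.1 + s.1) by abel]
  split_ifs with h
  · rw [structConst_neg_add r.2 s.2 h]
  · rw [coord_of_notMem]
    · simp
    · intro h'
      apply h
      simpa using neg_mem_roots h'

theorem adE_adE_sub_of_notMem (r s : Root) (hrs : r.1 + s.1 ≠ 0) (h : r.1 + s.1 ∉ roots) (v : L R) :
    adE r (adE s v) = adE s (adE r v) := by
  obtain rfl | hne := eq_or_ne r s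
  · rfl
  have hrs' : s.1 + r.1 ≠ 0 := by rwa [add_comm]
  have h' : s.1 + r.1 ∉ roots := by rwa [add_comm]
  refine adE_ext (fun i => ?_) fun p hp => ?_
  · rw [adE_fst_adE _ _ _ hrs, adE_fst_adE _ _ _ hrs', if_neg h, if_neg h']
    simp
  · rw [← sub_eq_zero]
    obtain hr | hr := eq_or_ne p r.1
    · rw [hr, coord_adE_adE_self hne v hrs, if_neg h, zero_mul]
    obtain hs | hs := eq_or_ne p s.1
    · rw [hs, ← neg_sub, coord_adE_adE_self hne.symm v hrs', if_neg h', zero_mul, neg_zero]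
    rw [coord_adE_adE r s v hrs hp hr hs fun e => h (e ▸ hp), if_neg h, zero_mul]

/-- The coroots interfere in the Cartan part and in the coefficients of `e_r`, `e_s` and `e_{r+s}`,
which are compared separately; for all other roots this is the Jacobi identity of `coord_adE_adE`.
-/
theorem adE_adE_sub_of_mem (r s : Root) (h : r.1 + s.1 ∈ roots) (v : L R) :
    adE r (adE s v) - adE s (adE r v) = (structConst r.1 s.1 : R) • adE ⟨r.1 + s.1, h⟩ v := by
  have hrs : r.1 + s.1 ≠ 0 := Root.ne_zero ⟨r.1 + s.1, h⟩
  have hrs' : s.1 + r.1 ≠ 0 := by rwa [add_comm]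
  have h' : s.1 + r.1 ∈ roots := by rwa [add_comm]
  have hN := structConst_comm_of_add_mem r.2 s.2 h
  have hrn : r.1 ≠ r.1 + s.1 := fun e => s.ne_zero (by simpa using e)
  have hsn : s.1 ≠ r.1 + s.1 := fun e => r.ne_zero (by simpa using e)
  have hne : r ≠ s := by
    rintro rfl
    have h1 := (add_mem_roots_iff r.2 r.2).1 h
    have h2 : form r.1 r.1 = 2 := r.2
    omega
  have hself (r s : Root) (h : r.1 + s.1 ∈ roots) :
      (structConst r.1 s.1 : R) * structConst (r.1 + s.1) (-s.1) = 1 := by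
    exact_mod_cast congrArg (Int.cast : ℤ → R) (structConst_mul_neg r.1 s.2)
  refine adE_ext (fun i => ?_) fun p hp => ?_
  · rw [Prod.fst_sub, Pi.sub_apply, adE_fst_adE _ _ _ hrs, adE_fst_adE _ _ _ hrs', if_pos h,
      if_pos h', hN, add_comm s.1, Prod.smul_fst, Pi.smul_apply, adE_fst, smul_eq_mul]
    push_cast [Pi.add_apply]
    ring
  · rw [coord_sub, coord_smul]
    obtain hr | hr := eq_or_ne p r.1
    · rw [hr, coord_adE_adE_self hne v hrs, if_pos h, coord_adE _ _ r.2 hrn,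
        show r.1 - (r.1 + s.1) = -s.1 by abel, ← mul_assoc, hself r s h]
    obtain hs | hs := eq_or_ne p s.1
    · rw [hs, ← neg_sub, coord_adE_adE_self hne.symm v hrs', if_pos h', coord_adE _ _ s.2 hsn,
        show s.1 - (r.1 + s.1) = -r.1 by abel, ← mul_assoc, ← neg_neg (structConst r.1 s.1), ← hN]
      have := hself s r h'
      rw [add_comm s.1] at this
      push_cast
      linear_combination coord v (-r.1) * this
    obtain hn | hn := eq_or_ne p (r.1 + s.1)
    · rw [hn, coord_adE r _ h hrn.symm, coord_adE s _ h hsn.symm, add_sub_cancel_left,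
        add_sub_cancel_right, coord_adE_self, coord_adE_self, coord_adE_self ⟨_, h⟩, hN]
      simp only [form_add_left]
      push_cast
      simp only [add_mul, Finset.sum_add_distrib]
      ring
    · rw [coord_adE_adE r s v hrs hp hr hs hn, if_pos h, coord_adE _ _ hp hn, mul_assoc]

end D4

/-- A Chevalley commutator relation for truncated exponentials: if `[a, b] = c` commutes with `a`
and `b` and the divided squares `a2 = a² / 2`, `b2 = b² / 2` are annihilated by `a`, `b`, then
`exp a exp b = exp c exp b exp a`. -/
theorem truncatedExp_mul_comm {E : Type*} [Ring E] {a b c a2 b2 c2 : E}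
    (t2 : ∀ z : E, 2 • z = 0 → z = 0) (t3 : ∀ z : E, 3 • z = 0 → z = 0)
    (hab : a * b = b * a + c) (hac : a * c = c * a) (hbc : b * c = c * b)
    (ha : a * a = 2 • a2) (hb : b * b = 2 • b2) (hc : c * c = 2 • c2)
    (ha3 : a * a2 = 0) (hb3 : b2 * b = 0) :
    (1 + a + a2) * (1 + b + b2) = (1 + c + c2) * ((1 + b + b2) * (1 + a + a2)) := by
  have ha3' : a * (a * a) = 0 := by rw [ha, mul_smul_comm, ha3, smul_zero]
  have hb3' : b * b * b = 0 := by rw [hb, smul_mul_assoc, hb3, smul_zero]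
  have haac : a * (c * a) = c * (a * a) := by rw [← mul_assoc, hac, mul_assoc]
  have hbbc : b * b * c = c * (b * b) := by rw [mul_assoc, hbc, ← mul_assoc, hbc, mul_assoc]
  have haab : a * a * b = b * (a * a) + 2 • (c * a) := by
    calc a * a * b = a * (a * b) := by noncomm_ring
      _ = a * (b * a + c) := by rw [hab]
      _ = a * b * a + a * c := by noncomm_ring
      _ = (b * a + c) * a + c * a := by rw [hab, hac]
      _ = _ := by noncomm_ring
  have habb : a * (b * b) = b * b * a + 2 • (c * b) := by
    calc a * (b * b) = a * b * b := by noncomm_ring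
      _ = (b * a + c) * b := by rw [hab]
      _ = b * (a * b) + c * b := by noncomm_ring
      _ = b * (b * a + c) + c * b := by rw [hab]
      _ = b * b * a + b * c + c * b := by noncomm_ring
      _ = _ := by rw [hbc]; noncomm_ring
  have haabb : a * a * (b * b) = b * b * (a * a) + 4 • (c * b * a) + 2 • (c * c) := by
    calc a * a * (b * b) = a * (a * (b * b)) := by noncomm_ring
      _ = a * (b * b * a + 2 • (c * b)) := by rw [habb]
      _ = a * (b * b) * a + 2 • (a * c * b) := by noncomm_ring
      _ = (b * b * a + 2 • (c * b)) * a + 2 • (c * a * b) := by rw [habb, hac]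
      _ = b * b * (a * a) + 2 • (c * b * a) + 2 • (c * (a * b)) := by noncomm_ring
      _ = _ := by rw [hab]; noncomm_ring
  -- Moving `b` past `a ^ 3 = 0` produces `3 • (c * a ^ 2)`, which must therefore vanish.
  have hcaa : c * (a * a) = 0 := by
    apply t3
    calc 3 • (c * (a * a)) = 2 • (c * (a * a)) + c * (a * a) := by abel
      _ = 2 • (a * (c * a)) + (b * a + c) * (a * a) - b * (a * (a * a)) := by
        rw [haac]; noncomm_ring
      _ = a * (b * (a * a) + 2 • (c * a)) - b * (a * (a * a)) := by rw [← hab]; noncomm_ring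
      _ = a * (a * a) * b - b * (a * (a * a)) := by rw [← haab]; noncomm_ring
      _ = 0 := by rw [ha3', zero_mul, mul_zero, sub_zero]
  have hcbb : c * (b * b) = 0 := by
    apply t3
    calc 3 • (c * (b * b)) = c * (b * b) + 2 • (c * (b * b)) := by abel
      _ = b * b * c + 2 • (c * (b * b)) := by rw [hbbc]
      _ = b * b * (b * a + c) + 2 • (c * (b * b)) - b * b * b * a := by noncomm_ring
      _ = (b * b * a + 2 • (c * b)) * b - b * b * b * a := by rw [← hab]; noncomm_ring
      _ = a * (b * b * b) - b * b * b * a := by rw [← habb]; noncomm_ring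
      _ = 0 := by rw [hb3', zero_mul, mul_zero, sub_zero]
  have hcca : c * c * a = 0 := by
    apply t2
    calc 2 • (c * c * a) = c * (b * (a * a) + 2 • (c * a)) - c * b * (a * a) := by noncomm_ring
      _ = c * (a * a) * b - b * (c * (a * a)) := by rw [← haab, ← hbc]; noncomm_ring
      _ = 0 := by rw [hcaa, zero_mul, mul_zero, sub_zero]
  have hccb : c * c * b = 0 := by
    apply t2
    calc 2 • (c * c * b) = c * (b * b * a + 2 • (c * b)) - c * (b * b) * a := by noncomm_ring
      _ = c * a * (b * b) - c * (b * b) * a := by rw [← habb]; noncomm_ring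
      _ = a * (c * (b * b)) - c * (b * b) * a := by rw [← hac]; noncomm_ring
      _ = 0 := by rw [hcbb, zero_mul, mul_zero, sub_zero]
  have hcba : c * b * (a * a) = 0 := by
    rw [← hbc, mul_assoc, hcaa, mul_zero]
  have hA : 2 • (1 + a + a2) = 2 • 1 + 2 • a + a * a := by rw [ha]; abel
  have hB : 2 • (1 + b + b2) = 2 • 1 + 2 • b + b * b := by rw [hb]; abel
  have hC : 2 • (1 + c + c2) = 2 • 1 + 2 • c + c * c := by rw [hc]; abel
  rw [← sub_eq_zero]
  -- The identity is multiplied by 8, one factor 2 for each of the three exponentials on the right,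
  -- to clear all divided squares.
  refine t2 _ (t2 _ (t2 _ ?_))
  have e1 : 2 • ((2 • 1 + 2 • a + a * a) * (2 • 1 + 2 • b + b * b)) =
      2 • ((2 • 1 + 2 • b + b * b) * (2 • 1 + 2 • a + a * a)) + 8 • c + 8 • (c * a) +
        8 • (c * b) + 8 • (c * b * a) + 4 • (c * c) := by
    calc 2 • ((2 • 1 + 2 • a + a * a) * (2 • 1 + 2 • b + b * b)) = 8 • 1 + 8 • a + 8 • b +
          4 • (a * a) + 4 • (b * b) + 8 • (a * b) + 4 • (a * a * b) + 4 • (a * (b * b)) +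
          2 • (a * a * (b * b)) := by noncomm_ring
      _ = _ := by rw [haabb, haab, habb, hab]; noncomm_ring
  have e2 : c * ((2 • 1 + 2 • b + b * b) * (2 • 1 + 2 • a + a * a)) =
      4 • c + 4 • (c * a) + 4 • (c * b) + 4 • (c * b * a) := by
    calc c * ((2 • 1 + 2 • b + b * b) * (2 • 1 + 2 • a + a * a)) = 4 • c + 4 • (c * a) +
          4 • (c * b) + 4 • (c * b * a) + 2 • (c * (a * a)) + 2 • (c * b * (a * a)) +
          c * (b * b) * (2 • 1 + 2 • a + a * a) := by noncomm_ring
      _ = _ := by rw [hcaa, hcba, hcbb]; noncomm_ring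
  have e3 : c * (4 • c + 4 • (c * a) + 4 • (c * b) + 4 • (c * b * a)) = 4 • (c * c) := by
    calc c * (4 • c + 4 • (c * a) + 4 • (c * b) + 4 • (c * b * a)) = 4 • (c * c) +
          4 • (c * c * a) + 4 • (c * c * b) + 4 • (c * c * b * a) := by noncomm_ring
      _ = _ := by rw [hcca, hccb]; noncomm_ring
  calc _ = 2 • ((2 • (1 + a + a2)) * (2 • (1 + b + b2))) -
        (2 • (1 + c + c2)) * ((2 • (1 + b + b2)) * (2 • (1 + a + a2))) := by
          simp only [smul_mul_assoc, mul_smul_comm, smul_sub]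
    _ = 2 • ((2 • 1 + 2 • a + a * a) * (2 • 1 + 2 • b + b * b)) -
        (2 • ((2 • 1 + 2 • b + b * b) * (2 • 1 + 2 • a + a * a)) +
        2 • (c * ((2 • 1 + 2 • b + b * b) * (2 • 1 + 2 • a + a * a))) +
        c * (c * ((2 • 1 + 2 • b + b * b) * (2 • 1 + 2 • a + a * a)))) := by
      rw [hA, hB, hC]
      congr 1
      generalize (2 • 1 + 2 • b + b * b) * (2 • 1 + 2 • a + a * a) = z
      noncomm_ring
    _ = 0 := by rw [e1, e2, e3]; noncomm_ring

namespace D4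

/-! ### Chevalley commutator relations -/

section

variable {R : Type*} [CommRing R]

theorem eq_zero_of_nsmul [IsDomain R] [CharZero R] {n : ℕ} (hn : n ≠ 0)
    (z : Module.End R (L R)) (h : n • z = 0) : z = 0 := by
  refine LinearMap.ext fun v => ?_
  have h1 : (n : R) • z v = 0 := by
    rw [Nat.cast_smul_eq_nsmul]
    simpa using LinearMap.congr_fun h v
  exact (smul_eq_zero.1 h1).resolve_left (Nat.cast_ne_zero.2 hn)

theorem adE_mul_self (r : Root) :
    (adE r * adE r : Module.End R (L R)) = 2 • adEDivSq r :=
  LinearMap.ext fun v => by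
    rw [Module.End.mul_apply, adE_adE, two_smul, two_smul]
    rfl

theorem smul_adE_mul_self (r : Root) (t : R) :
    (t • adE r) * (t • adE r) = 2 • (t ^ 2 • adEDivSq r : Module.End R (L R)) := by
  rw [smul_mul_smul_comm, adE_mul_self, smul_comm, pow_two]

theorem adE_mul_adEDivSq (r : Root) : (adE r * adEDivSq r : Module.End R (L R)) = 0 :=
  LinearMap.ext (adE_adEDivSq r)

theorem adEDivSq_mul_adE (r : Root) : (adEDivSq r * adE r : Module.End R (L R)) = 0 :=
  LinearMap.ext (adEDivSq_adE r)

theorem adE_mul_adE_comm {r s : Root} (hrs : r.1 + s.1 ≠ 0) (h : r.1 + s.1 ∉ roots) :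
    (adE r * adE s : Module.End R (L R)) = adE s * adE r :=
  LinearMap.ext (adE_adE_sub_of_notMem r s hrs h)

theorem adE_mul_adE {r s : Root} (h : r.1 + s.1 ∈ roots) :
    (adE r * adE s : Module.End R (L R)) =
      adE s * adE r + (structConst r.1 s.1 : R) • adE ⟨r.1 + s.1, h⟩ :=
  LinearMap.ext fun v => sub_eq_iff_eq_add'.1 (adE_adE_sub_of_mem r s h v)

theorem expAdE_mul_comm_of_charZero [IsDomain R] [CharZero R] {r s : Root} (hrs : r.1 + s.1 ≠ 0)
    (h : r.1 + s.1 ∉ roots) (t u : R) :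
    (expAdE r t * expAdE s u : Module.End R (L R)) = expAdE s u * expAdE r t := by
  have := truncatedExp_mul_comm (E := Module.End R (L R)) (c := 0) (c2 := 0) (eq_zero_of_nsmul two_ne_zero)
    (eq_zero_of_nsmul three_ne_zero)
    (show (t • adE r) * (u • adE s) = (u • adE s) * (t • adE r) + 0 by
      rw [smul_mul_smul_comm, smul_mul_smul_comm, adE_mul_adE_comm hrs h, mul_comm t, add_zero])
    (by simp) (by simp) (smul_adE_mul_self r t) (smul_adE_mul_self s u) (by simp)
    (by rw [smul_mul_smul_comm, adE_mul_adEDivSq, smul_zero])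
    (by rw [smul_mul_smul_comm, adEDivSq_mul_adE, smul_zero])
  rw [add_zero, add_zero, one_mul] at this
  exact this

theorem expAdE_mul_of_charZero [IsDomain R] [CharZero R] {r s : Root} (h : r.1 + s.1 ∈ roots)
    (t u : R) :
    (expAdE r t * expAdE s u : Module.End R (L R)) =
      expAdE ⟨r.1 + s.1, h⟩ (structConst r.1 s.1 * (t * u)) * (expAdE s u * expAdE r t) := by
  -- If `(p, q) ≥ 1`, then `p + q` is neither zero nor a root. This applies to `r`, `r + s` and to
  -- `s`, `r + s`, whose products are `2 - 1 = 1`.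
  have hnot (p q : Root) (hpq : 1 ≤ form p.1 q.1) :
      (adE p * adE q : Module.End R (L R)) = adE q * adE p := by
    apply adE_mul_adE_comm
    · intro h0
      have h1 : form p.1 (p.1 + q.1) = 0 := by rw [h0]; simp [form]
      have h2 : form p.1 p.1 = 2 := p.2
      rw [form_add_right] at h1
      omega
    · rw [add_mem_roots_iff p.2 q.2]
      omega
  have hf := (add_mem_roots_iff r.2 s.2).1 h
  have hr : form r.1 r.1 = 2 := r.2
  have hs : form s.1 s.1 = 2 := s.2
  have hc1 := hnot r ⟨_, h⟩ (by simp only [form_add_right]; omega)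
  have hc2 := hnot s ⟨_, h⟩ (by simp only [form_add_right, form_comm s.1 r.1]; omega)
  refine truncatedExp_mul_comm (E := Module.End R (L R)) (eq_zero_of_nsmul two_ne_zero)
    (eq_zero_of_nsmul three_ne_zero) ?_ ?_ ?_ (smul_adE_mul_self r t) (smul_adE_mul_self s u)
    (smul_adE_mul_self _ _)
    (by rw [smul_mul_smul_comm, adE_mul_adEDivSq, smul_zero])
    (by rw [smul_mul_smul_comm, adEDivSq_mul_adE, smul_zero])
  · rw [smul_mul_smul_comm, smul_mul_smul_comm, adE_mul_adE h, smul_add, smul_smul, mul_comm u t,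
      mul_comm (t * u)]
  · rw [smul_mul_smul_comm, smul_mul_smul_comm, hc1, mul_comm t]
  · rw [smul_mul_smul_comm, smul_mul_smul_comm, hc2, mul_comm u]

/-! ### Change of coefficient rings -/

/-- The map of Lie algebras induced by a ring homomorphism. -/
def mapL {R' : Type*} [CommRing R'] (f : R →+* R') (v : L R) : L R' :=
  (fun i => f (v.1 i), fun r => f (v.2 r))

theorem mapL_adE {R' : Type*} [CommRing R'] (f : R →+* R') (r : Root) (v : L R) :
    mapL f (adE r v) = adE r (mapL f v) := by
  refine Prod.ext (funext fun i => ?_) (funext fun s => ?_)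
  · simp [mapL, adE]
  · simp only [mapL, adE, LinearMap.coe_mk, AddHom.coe_mk]
    split_ifs <;> simp

theorem mapL_adEDivSq {R' : Type*} [CommRing R'] (f : R →+* R') (r : Root) (v : L R) :
    mapL f (adEDivSq r v) = adEDivSq r (mapL f v) := by
  refine Prod.ext (funext fun i => ?_) (funext fun s => ?_)
  · simp [mapL, adEDivSq]
  · simp only [mapL, adEDivSq, LinearMap.coe_mk, AddHom.coe_mk]
    split_ifs <;> simp

theorem mapL_expAdE {R' : Type*} [CommRing R'] (f : R →+* R') (r : Root) (t : R) (v : L R) :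
    mapL f (expAdE r t v) = expAdE r (f t) (mapL f v) := by
  have hadd (v w : L R) : mapL f (v + w) = mapL f v + mapL f w := by
    ext <;> simp [mapL]
  have hsmul (c : R) (w : L R) : mapL f (c • w) = f c • mapL f w := by
    ext <;> simp [mapL]
  simp only [expAdE, LinearMap.add_apply, LinearMap.smul_apply, LinearMap.id_apply, hadd, hsmul,
    mapL_adE, mapL_adEDivSq, map_pow]

/-- Every ring is a quotient of an integral polynomial ring, a domain of characteristic zero, so the
commutator relations need proof only there, where factors 2 and 3 cancel. -/
theorem exists_charZero_lift (R : Type*) [CommRing R] :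
    ∃ f : MvPolynomial R ℤ →+* R, Function.Surjective f :=
  ⟨MvPolynomial.eval₂Hom (Int.castRingHom R) id, fun a => ⟨MvPolynomial.X a, by simp⟩⟩

theorem mapL_surjective {R' : Type*} [CommRing R'] {f : R →+* R'} (hf : Function.Surjective f) :
    Function.Surjective (mapL f) := fun v =>
  ⟨(fun i => Function.surjInv hf (v.1 i), fun r => Function.surjInv hf (v.2 r)), by
    ext <;> simp [mapL, Function.surjInv_eq hf]⟩

theorem expAdE_comm {r s : Root} (hrs : r.1 + s.1 ≠ 0) (h : r.1 + s.1 ∉ roots) (t u : R) (v : L R) :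
    expAdE r t (expAdE s u v) = expAdE s u (expAdE r t v) := by
  obtain ⟨f, hf⟩ := exists_charZero_lift R
  obtain ⟨t, rfl⟩ := hf t
  obtain ⟨u, rfl⟩ := hf u
  obtain ⟨v, rfl⟩ := mapL_surjective hf v
  simp only [← mapL_expAdE]
  exact congrArg _ (LinearMap.congr_fun (expAdE_mul_comm_of_charZero hrs h t u) v)

theorem expAdE_expAdE {r s : Root} (h : r.1 + s.1 ∈ roots) (t u : R) (v : L R) :
    expAdE r t (expAdE s u v) =
      expAdE ⟨r.1 + s.1, h⟩ (structConst r.1 s.1 * (t * u)) (expAdE s u (expAdE r t v)) := by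
  obtain ⟨f, hf⟩ := exists_charZero_lift R
  obtain ⟨t, rfl⟩ := hf t
  obtain ⟨u, rfl⟩ := hf u
  obtain ⟨v, rfl⟩ := mapL_surjective hf v
  rw [← map_intCast f, ← map_mul, ← map_mul]
  simp only [← mapL_expAdE]
  exact congrArg _ (LinearMap.congr_fun (expAdE_mul_of_charZero h t u) v)

end

/-! ### The root elements of `U` -/

section

variable {F : Type*} [Field F]

theorem exists_posRoot (α : PosRoot) : ∃ i, posRoot i = α := by
  obtain ⟨i, hi⟩ := exists_rootVec_eq α.2
  exact ⟨i, Subtype.ext hi⟩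

theorem x_ext {g h : U F} (H : ∀ v, g.1 v = h.1 v) : g = h :=
  Subtype.ext (LinearEquiv.ext H)

theorem x_mul (α : PosRoot) (t u : F) : x α t * x α u = x α (t + u) :=
  x_ext fun v => expAdE_add α.toRoot t u v

theorem x_zero (α : PosRoot) : x α (0 : F) = 1 := x_ext fun v => expAdE_zero v α.toRoot

theorem x_neg (α : PosRoot) (t : F) : x α (-t) = (x α t)⁻¹ := by
  rw [eq_inv_iff_mul_eq_one, x_mul, neg_add_cancel, x_zero]

theorem x_mem_X (α : PosRoot) (t : F) : x α t ∈ X F α :=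
  Subgroup.subset_closure ⟨t, rfl⟩

theorem mem_X_iff {α : PosRoot} {g : U F} : g ∈ X F α ↔ ∃ t, x α t = g := by
  refine ⟨fun h => ?_, fun ⟨t, h⟩ => h ▸ x_mem_X α t⟩
  induction h using Subgroup.closure_induction with
  | mem g h => exact h
  | one => exact ⟨0, x_zero α⟩
  | mul g h _ _ hg hh =>
    obtain ⟨t, rfl⟩ := hg
    obtain ⟨u, rfl⟩ := hh
    exact ⟨t + u, (x_mul α t u).symm⟩
  | inv g _ hg =>
    obtain ⟨t, rfl⟩ := hg
    exact ⟨-t, x_neg α t⟩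

theorem add_ne_zero_of_mem_posRoots {v w : Fin 4 → ℤ} (hv : v ∈ posRoots) (hw : w ∈ posRoots) :
    v + w ≠ 0 := by
  intro h
  apply Root.ne_zero ⟨v, hv.1⟩
  funext i
  have h1 := hv.2 i
  have h2 := hw.2 i
  have h3 := congrFun h i
  simp only [Pi.add_apply, Pi.zero_apply] at *
  omega

theorem x_comm {α β : PosRoot} (h : ∀ γ : PosRoot, α.1 + β.1 ≠ γ.1) (t u : F) :
    x α t * x β u = x β u * x α t :=
  x_ext fun v => expAdE_comm (r := α.toRoot) (s := β.toRoot) (add_ne_zero_of_mem_posRoots α.2 β.2)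
    (fun h' => h ⟨_, h', fun i => add_nonneg (α.2.2 i) (β.2.2 i)⟩ rfl) t u v

theorem x_mul_x {α β γ : PosRoot} (h : α.1 + β.1 = γ.1) (t u : F) :
    x α t * x β u = x γ (structConst α.1 β.1 * (t * u)) * (x β u * x α t) := by
  obtain ⟨γ, hγ⟩ := γ
  subst h
  exact x_ext fun v => expAdE_expAdE (r := α.toRoot) (s := β.toRoot) hγ.1 t u v

theorem conj_x_mem {N : Subgroup (U F)} {α β : PosRoot}
    (h : ∀ γ : PosRoot, α.1 + β.1 = γ.1 → X F γ ≤ N) (hβ : X F β ≤ N) (t u : F) :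
    x α t * x β u * (x α t)⁻¹ ∈ N := by
  by_cases h' : ∃ γ : PosRoot, α.1 + β.1 = γ.1
  · obtain ⟨γ, hγ⟩ := h'
    rw [x_mul_x hγ, mul_assoc, mul_assoc, mul_inv_cancel, mul_one]
    exact mul_mem (h γ hγ (x_mem_X _ _)) (hβ (x_mem_X _ _))
  · rw [x_comm (not_exists.1 h'), mul_assoc, mul_inv_cancel, mul_one]
    exact hβ (x_mem_X _ _)

/-- `X_α` normalizes the subgroup generated by the `X_β`, `β ∈ S`, if all roots `α + β` with
`β ∈ S` belong to `S`. -/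
theorem X_le_normalizer {S : Set PosRoot} {α : PosRoot}
    (h : ∀ β ∈ S, ∀ γ : PosRoot, α.1 + β.1 = γ.1 → γ ∈ S) :
    X F α ≤ Subgroup.normalizer ((⨆ β ∈ S, X F β : Subgroup (U F)) : Set (U F)) := by
  set N : Subgroup (U F) := ⨆ β ∈ S, X F β with hN
  have hle (β) (hβ : β ∈ S) : X F β ≤ N := le_iSup₂_of_le β hβ le_rfl
  have hc (t : F) : N ≤ N.comap (MulAut.conj (x α t)).toMonoidHom := by
    rw [hN]
    refine iSup₂_le fun β hβ => ?_
    rw [← hN]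
    intro g hg
    obtain ⟨u, rfl⟩ := mem_X_iff.1 hg
    exact conj_x_mem (fun γ hγ => hle γ (h β hβ γ hγ)) (hle β hβ) t u
  intro g hg
  obtain ⟨t, rfl⟩ := mem_X_iff.1 hg
  rw [Subgroup.mem_normalizer_iff]
  refine fun n => ⟨fun hn => hc t hn, fun hn => ?_⟩
  have := hc (-t) hn
  simpa [x_neg, mul_assoc] using this

theorem closure_range_x : Subgroup.closure {g | ∃ (α : PosRoot) (t : F), g = x α t} = ⊤ := by
  refine eq_top_iff.2 ((Subgroup.closure_closure_coe_preimage
    (k := {g | ∃ (α : PosRoot) (t : F), g = rootElt α.toRoot t})).ge.trans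
    (Subgroup.closure_mono ?_))
  rintro g ⟨α, t, h⟩
  exact ⟨α, t, Subtype.ext h⟩

theorem iSup_X : (⨆ α, X F α) = ⊤ := by
  rw [eq_top_iff, ← closure_range_x, Subgroup.closure_le]
  rintro g ⟨α, t, rfl⟩
  exact le_iSup (X F) α (x_mem_X α t)

end

/-! ### Ordered products -/

/-- The sum of the first entry and a later entry is again a later entry if it is a root, and
likewise for all tails of the list. -/
def SumClosed : List (Fin 12) → Prop
  | [] => True
  | i :: l => (∀ j ∈ l, ∀ k, rootVec i + rootVec j = rootVec k → k ∈ l) ∧ SumClosed l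

/-- Decidability of `SumClosed`. -/
def decidableSumClosed : ∀ l, Decidable (SumClosed l)
  | [] => isTrue trivial
  | _ :: l =>
    have := decidableSumClosed l
    inferInstanceAs (Decidable (_ ∧ _))

instance : DecidablePred SumClosed := decidableSumClosed

variable {F : Type*} [Field F]

/-- The product of the root elements `x_i (d i)` in the order of the list `l`. -/
def prodList (l : List (Fin 12)) (d : Fin 12 → F) : U F := (l.map fun i => x (posRoot i) (d i)).prod

variable (F) in
/-- The subgroup generated by the root subgroups of the entries of the list `l`. -/
def spanList (l : List (Fin 12)) : Subgroup (U F) := ⨆ α ∈ {α | ∃ i ∈ l, posRoot i = α}, X F α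

theorem spanList_cons (i : Fin 12) (l : List (Fin 12)) :
    spanList F (i :: l) = X F (posRoot i) ⊔ spanList F l := by
  simp only [spanList, List.mem_cons, exists_eq_or_imp, Set.mem_ofPred_eq, iSup_or, iSup_sup_eq,
    iSup_iSup_eq_right]

theorem prodList_congr {l : List (Fin 12)} {d d' : Fin 12 → F} (h : ∀ i ∈ l, d i = d' i) :
    prodList l d = prodList l d' := by
  unfold prodList
  congr 1
  exact List.map_congr_left fun i hi => by rw [h i hi]

theorem prodList_append (l l' : List (Fin 12)) (d : Fin 12 → F) :
    prodList (l ++ l') d = prodList l d * prodList l' d := by simp [prodList]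

theorem prodList_cons (i : Fin 12) (l : List (Fin 12)) (d : Fin 12 → F) :
    prodList (i :: l) d = x (posRoot i) (d i) * prodList l d := by simp [prodList]

theorem prodList_mem_spanList (l : List (Fin 12)) (d : Fin 12 → F) :
    prodList l d ∈ spanList F l := by
  induction l with
  | nil => exact one_mem _
  | cons i l ih =>
    rw [prodList_cons, spanList_cons]
    exact mul_mem (Subgroup.mem_sup_left (x_mem_X _ _)) (Subgroup.mem_sup_right ih)

/-- The first root subgroup normalizes the group generated by the later ones, so their join is the
product set; induct on the tail. -/
theorem exists_prodList_eq {l : List (Fin 12)} (hn : l.Nodup) (hl : SumClosed l) {g : U F}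
    (hg : g ∈ spanList F l) : ∃ d, prodList l d = g := by
  induction l generalizing g with
  | nil =>
    refine ⟨0, ?_⟩
    simpa [spanList, prodList, eq_comm] using hg
  | cons i l ih =>
    have hle : X F (posRoot i) ≤ Subgroup.normalizer (spanList F l : Set (U F)) := by
      refine X_le_normalizer ?_
      rintro _ ⟨j, hj, rfl⟩ γ hγ
      obtain ⟨k, rfl⟩ := exists_posRoot γ
      exact ⟨k, hl.1 j hj k hγ, rfl⟩
    rw [spanList_cons, ← SetLike.mem_coe,
      Subgroup.coe_mul_of_left_le_normalizer_right _ _ hle] at hg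
    obtain ⟨a, ha, b, hb, rfl⟩ := hg
    obtain ⟨t, rfl⟩ := mem_X_iff.1 ha
    obtain ⟨d, rfl⟩ := ih (List.nodup_cons.1 hn).2 hl.2 hb
    refine ⟨Function.update d i t, ?_⟩
    rw [prodList_cons, Function.update_self]
    dsimp only
    congr 1
    refine prodList_congr fun j hj => Function.update_of_ne ?_ _ _
    rintro rfl
    exact (List.nodup_cons.1 hn).1 hj

theorem prodList_filter (l : List (Fin 12)) (p : Fin 12 → Prop) [DecidablePred p] {d : Fin 12 → F}
    (h : ∀ i, ¬ p i → d i = 0) : prodList (l.filter p) d = prodList l d := by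
  induction l with
  | nil => rfl
  | cons i l ih =>
    by_cases hi : p i
    · rw [List.filter_cons_of_pos (by simpa using hi), prodList_cons, prodList_cons, ih]
    · rw [List.filter_cons_of_neg (by simpa using hi), prodList_cons, ih, h i hi, x_zero, one_mul]

/-! ### Combinatorics of the legs -/

theorem posRoot_injective : Function.Injective posRoot := by
  intro i j h
  have h' : rootVec i = rootVec j := congrArg Subtype.val h
  revert i j
  decide

/-- Membership in the hook of a positive root, in terms of the numbering. -/
def InHook (a i : Fin 12) : Prop := i = a ∨ ∃ j, rootVec i + rootVec j = rootVec a

instance (a i : Fin 12) : Decidable (InHook a i) := inferInstanceAs (Decidable (_ ∨ _))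

/-- Membership in the leg of a positive root, in terms of the numbering. -/
def InLeg (a i : Fin 12) : Prop :=
  InHook a i ∧ i ≠ a ∧ (if a = 11 then i ≠ 7 ∧ i ≠ 8 ∧ i ≠ 9 ∧ i ≠ 10 else ¬ InHook 11 i)

instance (a i : Fin 12) : Decidable (InLeg a i) := inferInstanceAs (Decidable (_ ∧ _ ∧ _))

theorem posRoot_mem_hook {a i : Fin 12} : posRoot i ∈ hook (posRoot a) ↔ InHook a i := by
  constructor
  · rintro ⟨v, hv | rfl, h⟩
    · obtain ⟨j, rfl⟩ := exists_rootVec_eq hv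
      exact Or.inr ⟨j, h⟩
    · rw [add_zero] at h
      exact Or.inl (posRoot_injective (Subtype.ext h))
  · rintro (rfl | ⟨j, h⟩)
    · exact ⟨0, Or.inr rfl, add_zero _⟩
    · exact ⟨rootVec j, Or.inl (rootVec_mem j), h⟩

theorem posRoot_mem_leg {a i : Fin 12} : posRoot i ∈ leg (posRoot a) ↔ InLeg a i := by
  have h (i j : Fin 12) : posRoot i = posRoot j ↔ i = j := posRoot_injective.eq_iff
  unfold leg arm InLeg
  simp only [h]
  split_ifs with ha
  · simp only [Set.mem_sdiff, posRoot_mem_hook, Set.mem_union, Set.mem_insert_iff,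
      Set.mem_singleton_iff, h]
    tauto
  · simp only [Set.mem_sdiff, posRoot_mem_hook, Set.mem_union, Set.mem_inter_iff,
      Set.mem_singleton_iff, h]
    tauto

/-- The numbers of the roots in the leg of `α_a`. -/
def legList (a : Fin 12) : List (Fin 12) := (List.finRange 12).filter (InLeg a)

/-- The numbers of the positive roots outside the leg of `α_a`. -/
def restList (a : Fin 12) : List (Fin 12) := (List.finRange 12).filter fun i => ¬ InLeg a i

theorem mem_legList {a i : Fin 12} : i ∈ legList a ↔ InLeg a i := by simp [legList]

theorem mem_restList {a i : Fin 12} : i ∈ restList a ↔ ¬ InLeg a i := by simp [restList]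

/-- With the leg placed first, one check serves twice: the whole list factors `U`, and its tail
`restList a` factors `V_α`. -/
theorem sumClosed_append (a : Fin 12) : SumClosed (legList a ++ restList a) := by
  revert a
  decide +kernel

theorem nodup_append (a : Fin 12) : (legList a ++ restList a).Nodup := by
  revert a
  decide +kernel

theorem SumClosed.of_append {l l' : List (Fin 12)} (h : SumClosed (l ++ l')) : SumClosed l' := by
  induction l with
  | nil => exact h
  | cons i l ih => exact ih h.2

theorem nodup_restList (a : Fin 12) : (restList a).Nodup := (List.nodup_finRange 12).filter _

theorem height_lt_of_inLeg {a i : Fin 12} (h : InLeg a i) :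
    height (rootVec i) < height (rootVec a) := by
  revert a i
  decide +kernel

theorem not_inLeg_self (a : Fin 12) : ¬ InLeg a a := fun h => h.2.1 rfl

/-- Hence `α` is not a sum of two roots outside its leg, which is why `X_α` can carry a nontrivial
linear character of `V_α`. -/
theorem inLeg_of_add_eq {a i j : Fin 12} (h : rootVec i + rootVec j = rootVec a)
    (hi : ¬ InLeg a i) : InLeg a j := by
  revert a i j
  decide +kernel

theorem not_inLeg_of_add_eq {a i j k : Fin 12} (h : rootVec i + rootVec j = rootVec k)
    (hi : ¬ InLeg a i) (hj : ¬ InLeg a j) : ¬ InLeg a k := by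
  revert a i j k
  decide +kernel

/-- The arm partner `α_j` of the leg root `α_i` meets no other leg root in a commutator, and `X_α`
commutes with the leg. So conjugating `x_j` by a leg product detects the single coordinate at `i`.
-/
theorem exists_arm {a i : Fin 12} (h : InLeg a i) : ∃ j, ¬ InLeg a j ∧
    rootVec j + rootVec i = rootVec a ∧ (∀ k, rootVec a + rootVec i ≠ rootVec k) ∧
    ∀ i', InLeg a i' → i' ≠ i → (∀ k, rootVec j + rootVec i' ≠ rootVec k) ∧
      ∀ k, rootVec a + rootVec i' ≠ rootVec k := by
  revert a i
  decide +kernel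

/-! ### The subgroups `V_α` -/

theorem V_eq_spanList (a : Fin 12) : V F (posRoot a) = spanList F (restList a) := by
  unfold V spanList
  have : (leg (posRoot a))ᶜ = {α | ∃ i ∈ restList a, posRoot i = α} := by
    ext α
    obtain ⟨i, rfl⟩ := exists_posRoot α
    simp [posRoot_mem_leg, mem_restList, posRoot_injective.eq_iff]
  rw [this]

theorem spanList_eq_top (a : Fin 12) : spanList F (legList a ++ restList a) = ⊤ := by
  rw [eq_top_iff, ← iSup_X]
  refine iSup_le fun α => ?_
  obtain ⟨i, rfl⟩ := exists_posRoot α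
  refine le_iSup₂_of_le (posRoot i) ⟨i, ?_, rfl⟩ le_rfl
  rw [List.mem_append, mem_legList, mem_restList]
  exact em _

theorem coe_V (α : PosRoot) : (V F α : Set (U F)) = prodSet F α := by
  obtain ⟨a, rfl⟩ := exists_posRoot α
  have hofFn (d : Fin 12 → F) :
      (List.ofFn fun i => x (posRoot i) (d i)).prod = prodList (List.finRange 12) d := by
    rw [List.ofFn_eq_map]
    rfl
  ext g
  rw [SetLike.mem_coe, V_eq_spanList]
  constructor
  · intro hg
    obtain ⟨d, rfl⟩ := exists_prodList_eq (nodup_restList a) (sumClosed_append a).of_append hg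
    -- Coordinates on the leg are reset to zero; elsewhere those of the given product are kept.
    refine ⟨fun i => if InLeg a i then 0 else d i, fun i hi => if_pos (posRoot_mem_leg.1 hi), ?_⟩
    rw [hofFn, ← prodList_filter _ (fun i => ¬ InLeg a i) fun i hi => if_pos (not_not.1 hi)]
    exact prodList_congr fun i hi => (if_neg (mem_restList.1 hi)).symm
  · rintro ⟨d, hd, rfl⟩
    rw [hofFn, ← prodList_filter _ (fun i => ¬ InLeg a i) fun i hi =>
      hd i (posRoot_mem_leg.2 (not_not.1 hi))]
    exact prodList_mem_spanList _ _

theorem x_mem_V {a i : Fin 12} (h : ¬ InLeg a i) (t : F) : x (posRoot i) t ∈ V F (posRoot a) :=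
  (le_iSup₂_of_le (f := fun γ (_ : γ ∈ (leg (posRoot a))ᶜ) => X F γ) (posRoot i)
    (fun h' => h (posRoot_mem_leg.1 h')) le_rfl) (x_mem_X _ _)

/-- Every element of `U` is the product of root elements for the leg and an element of `V_α`. -/
theorem exists_legList_mul (a : Fin 12) (g : U F) :
    ∃ d : Fin 12 → F, ∃ v ∈ V F (posRoot a), g = prodList (legList a) d * v := by
  obtain ⟨d, rfl⟩ := exists_prodList_eq (nodup_append a) (sumClosed_append a)
    (g := g) (by rw [spanList_eq_top]; trivial)
  refine ⟨d, prodList (restList a) d, ?_, prodList_append _ _ _⟩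
  rw [V_eq_spanList]
  exact prodList_mem_spanList _ _

/-! ### The linear characters of `V_α` -/

section

theorem mem_posRoots_or_neg {p : Fin 4 → ℤ} (hp : p ∈ roots) : p ∈ posRoots ∨ -p ∈ posRoots := by
  obtain ⟨a, b, c, d, rfl⟩ := vec_eq_fin_sub_two hp
  refine (?_ : _ ∨ _).imp (And.intro hp) (And.intro (neg_mem_roots hp))
  revert a b c d
  decide +kernel

theorem neg_notMem_posRoots {p : Fin 4 → ℤ} (hp : p ∈ posRoots) : -p ∉ posRoots := fun h =>
  add_ne_zero_of_mem_posRoots hp h (add_neg_cancel p)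

variable {F : Type*} [Field F]

/-- The vector `e_{-α_a}`. -/
noncomputable def negVec (F : Type*) [Field F] (a : Fin 12) : L F :=
  (0, fun r => open scoped Classical in if r.1 = -rootVec a then 1 else 0)

/-- The coroot of `α_a`. -/
def corootVec (F : Type*) [Field F] (a : Fin 12) : L F := (fun i => (rootVec a i : F), 0)

theorem coord_negVec (a : Fin 12) {p : Fin 4 → ℤ} (hp : p ≠ -rootVec a) :
    coord (negVec F a) p = 0 := by
  simp [coord, negVec, hp]

theorem coord_negVec_self (a : Fin 12) : coord (negVec F a) (-rootVec a) = 1 := by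
  simp [coord, negVec, neg_mem_roots (rootVec_mem a).1]

theorem coord_corootVec (a : Fin 12) (p : Fin 4 → ℤ) : coord (corootVec F a) p = 0 := by
  simp [coord, corootVec]

/-- The span of the `e_β` with `β` positive or `-β` in the leg of `α_a`. -/
def legSpace (F : Type*) [Field F] (a : Fin 12) : Submodule F (L F) where
  carrier := {v | v.1 = 0 ∧ ∀ p : Root, p.1 ∉ posRoots → (∀ i, InLeg a i → p.1 ≠ -rootVec i) →
    v.2 p = 0}
  zero_mem' := ⟨rfl, fun _ _ _ => rfl⟩
  add_mem' h h' := ⟨by simp [h.1, h'.1], fun p hp hp' => by simp [h.2 p hp hp', h'.2 p hp hp']⟩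
  smul_mem' c v h := ⟨by simp [h.1], fun p hp hp' => by simp [h.2 p hp hp']⟩

theorem coord_of_mem_legSpace {a : Fin 12} {v : L F} (hv : v ∈ legSpace F a) {p : Fin 4 → ℤ}
    (hp : p ∉ posRoots) (hp' : ∀ i, InLeg a i → p ≠ -rootVec i) : coord v p = 0 := by
  unfold coord
  split_ifs with h
  · exact hv.2 ⟨p, h⟩ hp hp'
  · rfl

theorem adEDivSq_mem_legSpace (a : Fin 12) (α : PosRoot) (v : L F) :
    adEDivSq α.toRoot v ∈ legSpace F a := by
  refine ⟨rfl, fun p hp _ => if_neg ?_⟩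
  rintro rfl
  exact hp α.2

theorem adE_mem_legSpace_of_coord {a i : Fin 12} {v : L F} (h0 : coord v (-rootVec i) = 0)
    (h : ∀ p ∈ roots, p ∉ posRoots → (∀ j, InLeg a j → p ≠ -rootVec j) →
      coord v (p - rootVec i) = 0) :
    adE (posRoot i).toRoot v ∈ legSpace F a := by
  refine ⟨funext fun k => ?_, fun p hp hp' => ?_⟩
  · rw [adE_fst]
    change _ * coord v (-rootVec i) = 0
    rw [h0, mul_zero]
  · rw [← coord_root, coord_adE _ _ p.2]
    · change _ * coord v (p.1 - rootVec i) = 0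
      rw [h p.1 p.2 hp hp', mul_zero]
    · intro e
      exact hp (e ▸ rootVec_mem i)

theorem exists_neg_rootVec {p : Fin 4 → ℤ} (hp : p ∈ roots) (hn : p ∉ posRoots) :
    ∃ k, p = -rootVec k := by
  obtain ⟨k, hk⟩ := exists_rootVec_eq ((mem_posRoots_or_neg hp).resolve_left hn)
  exact ⟨k, by rw [hk, neg_neg]⟩

theorem adE_mem_legSpace {a i : Fin 12} (hi : ¬ InLeg a i) {v : L F} (hv : v ∈ legSpace F a) :
    adE (posRoot i).toRoot v ∈ legSpace F a := by
  refine adE_mem_legSpace_of_coord ?_ fun p hp hn hp' => ?_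
  · refine coord_of_mem_legSpace hv (neg_notMem_posRoots (rootVec_mem i)) fun j hj e => hi ?_
    rwa [posRoot_injective (Subtype.ext (neg_injective e) : posRoot i = posRoot j)]
  · obtain ⟨k, rfl⟩ := exists_neg_rootVec hp hn
    refine coord_of_mem_legSpace hv (fun h => ?_) fun j hj e => ?_
    · refine hn ⟨hp, fun m => ?_⟩
      have h1 := h.2 m
      have h2 := (rootVec_mem i).2 m
      simp only [Pi.sub_apply] at h1
      omega
    · refine hp' k ?_ rfl
      by_contra hk
      -- Here `α_k + α_i = α_j` with `α_j` in the leg and `α_i` outside; by closure of the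
      -- complement, `α_k` lies in the leg.
      refine not_inLeg_of_add_eq (k := j) ?_ hi hk hj
      rw [← neg_injective.eq_iff, ← e]
      abel

theorem adE_corootVec_mem_legSpace (a i : Fin 12) :
    adE (posRoot i).toRoot (corootVec F a) ∈ legSpace F a :=
  adE_mem_legSpace_of_coord (coord_corootVec _ _) fun _ _ _ _ => coord_corootVec _ _

/-- For `i ≠ a` the image is zero or a multiple of `e_{α_i - α}`, whose root is positive or the
negative of a leg root by `inLeg_of_add_eq`; for `i = a` it is the coroot. -/
theorem adE_negVec_mem_legSpace {a i : Fin 12} (hi : ¬ InLeg a i) :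
    adE (posRoot i).toRoot (negVec F a) - (if i = a then 1 else 0 : F) • corootVec F a ∈
      legSpace F a := by
  have hp2 {p : Fin 4 → ℤ} (hp : p ∈ roots) (hn : p ∉ posRoots)
      (hp' : ∀ j, InLeg a j → p ≠ -rootVec j) : coord (negVec F a) (p - rootVec i) = 0 := by
    obtain ⟨k, rfl⟩ := exists_neg_rootVec hp hn
    refine coord_negVec a fun e => hp' k (inLeg_of_add_eq ?_ hi) rfl
    rw [← neg_injective.eq_iff, ← e]
    abel
  split_ifs with h
  · subst h
    refine ⟨funext fun k => ?_, fun p hp hp' => ?_⟩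
    · rw [Prod.fst_sub, Pi.sub_apply, adE_fst]
      change _ * coord (negVec F i) (-rootVec i) - _ = 0
      rw [coord_negVec_self]
      simp [corootVec, posRoot, PosRoot.toRoot]
    · rw [← coord_root, coord_sub, coord_smul, coord_corootVec, mul_zero, sub_zero,
        coord_adE _ _ p.2 fun e => hp (by rw [e]; exact rootVec_mem i)]
      change _ * coord (negVec F i) (p.1 - rootVec i) = 0
      rw [hp2 p.2 hp hp', mul_zero]
  · rw [zero_smul, sub_zero]
    refine adE_mem_legSpace_of_coord (coord_negVec a fun e => h ?_) fun p hp hn hp' => hp2 hp hn hp'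
    exact posRoot_injective (Subtype.ext (neg_injective e))

/-- `u` stabilizes `legSpace` and acts unipotently on the span of `e_{-α}` and the coroot of `α`
modulo `legSpace`, with matrix coefficient `c`. -/
structure ActsBy (a : Fin 12) (u : U F) (c : F) : Prop where
  negVec_sub : u.1 (negVec F a) - negVec F a - c • corootVec F a ∈ legSpace F a
  coroot_sub : u.1 (corootVec F a) - corootVec F a ∈ legSpace F a
  mem : ∀ v ∈ legSpace F a, u.1 v ∈ legSpace F a

theorem ActsBy.one (a : Fin 12) : ActsBy a (1 : U F) 0 where
  negVec_sub := by simp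
  coroot_sub := by simp
  mem v hv := hv

theorem ActsBy.mul {a : Fin 12} {u w : U F} {c d : F} (hu : ActsBy a u c) (hw : ActsBy a w d) :
    ActsBy a (u * w) (c + d) where
  negVec_sub := by
    have h1 := hu.mem _ hw.negVec_sub
    rw [map_sub, map_sub, map_smul] at h1
    have h2 := add_mem (add_mem h1 hu.negVec_sub) ((legSpace F a).smul_mem d hu.coroot_sub)
    convert h2 using 1
    change u.1 (w.1 (negVec F a)) - _ - _ = _
    module
  coroot_sub := by
    have h1 := hu.mem _ hw.coroot_sub
    rw [map_sub] at h1
    have h2 := add_mem h1 hu.coroot_sub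
    rwa [sub_add_sub_cancel] at h2
  mem v hv := hu.mem _ (hw.mem v hv)

theorem actsBy_x {a i : Fin 12} (hi : ¬ InLeg a i) (t : F) :
    ActsBy a (x (posRoot i) t) (if i = a then t else 0) := by
  have hx (v : L F) : (x (posRoot i) t).1 v =
    v + t • adE (posRoot i).toRoot v + t ^ 2 • adEDivSq (posRoot i).toRoot v := rfl
  have hsq (v : L F) := (legSpace F a).smul_mem (t ^ 2) (adEDivSq_mem_legSpace a (posRoot i) v)
  refine ⟨?_, ?_, fun v hv => ?_⟩
  · have := add_mem ((legSpace F a).smul_mem t (adE_negVec_mem_legSpace hi)) (hsq (negVec F a))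
    convert this using 1
    rw [hx]
    split_ifs <;> module
  · have := add_mem ((legSpace F a).smul_mem t (adE_corootVec_mem_legSpace a i))
      (hsq (corootVec F a))
    convert this using 1
    rw [hx]
    module
  · rw [hx]
    exact add_mem (add_mem hv ((legSpace F a).smul_mem t (adE_mem_legSpace hi hv))) (hsq v)

theorem exists_actsBy {a : Fin 12} {u : U F} (hu : u ∈ V F (posRoot a)) : ∃ c, ActsBy a u c := by
  rw [V_eq_spanList] at hu
  obtain ⟨d, rfl⟩ := exists_prodList_eq (nodup_restList a) (sumClosed_append a).of_append hu
  have key (l : List (Fin 12)) (hl : ∀ i ∈ l, ¬ InLeg a i) : ∃ c, ActsBy a (prodList l d) c := by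
    induction l with
    | nil => exact ⟨0, ActsBy.one a⟩
    | cons i l ih =>
      obtain ⟨c, hc⟩ := ih fun j hj => hl j (List.mem_cons_of_mem _ hj)
      rw [prodList_cons]
      exact ⟨_, (actsBy_x (hl i List.mem_cons_self) (d i)).mul hc⟩
  exact key _ fun i hi => mem_restList.1 hi

theorem exists_rootVec_apply_eq_one (a : Fin 12) : ∃ m, rootVec a m = 1 := by
  revert a
  decide

/-- Some coordinate of the coroot is 1, so it is nonzero modulo `legSpace` in every characteristic.
-/
theorem ActsBy.unique {a : Fin 12} {u : U F} {c d : F} (h : ActsBy a u c) (h' : ActsBy a u d) :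
    c = d := by
  have h1 := (sub_mem h.negVec_sub h'.negVec_sub).1
  obtain ⟨m, hm⟩ := exists_rootVec_apply_eq_one a
  have h2 := congrFun h1 m
  simp [corootVec, hm] at h2
  exact (sub_eq_zero.1 h2).symm

/-- The matrix coefficient of an element of `V_α`, as a homomorphism. -/
noncomputable def coeffHom (F : Type*) [Field F] (a : Fin 12) :
    V F (posRoot a) →* Multiplicative F where
  toFun u := .ofAdd (exists_actsBy u.2).choose
  map_one' := (exists_actsBy (one_mem (V F (posRoot a)))).choose_spec.unique (ActsBy.one a)
  map_mul' u w := (exists_actsBy (mul_mem u.2 w.2)).choose_spec.unique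
    ((exists_actsBy u.2).choose_spec.mul (exists_actsBy w.2).choose_spec)

theorem coeffHom_eq {a : Fin 12} {u : V F (posRoot a)} {c : F} (h : ActsBy a u.1 c) :
    (coeffHom F a u).toAdd = c :=
  (exists_actsBy u.2).choose_spec.unique h

theorem exists_isLambda (φ : AddChar F ℂ) (α : PosRoot) (s : F) :
    ∃ l : V F α →* ℂˣ, IsLambda φ α s l := by
  obtain ⟨a, rfl⟩ := exists_posRoot α
  let f : V F (posRoot a) →* ℂ := (AddChar.mulShift φ s).toMonoidHom.comp (coeffHom F a)
  have hf {u : V F (posRoot a)} {c : F} (h : ActsBy a u.1 c) : f u = φ (s * c) :=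
    congrArg (fun c => φ (s * c)) (coeffHom_eq h)
  refine ⟨f.toHomUnits, fun d => ⟨x_mem_V (not_inLeg_self a) d, ?_⟩, fun γ hγ g hg => ?_⟩
  · have := actsBy_x (not_inLeg_self a) d
    rw [if_pos rfl] at this
    exact hf this
  · obtain ⟨j, rfl⟩ := exists_posRoot γ
    obtain ⟨t, rfl⟩ := mem_X_iff.1 hg
    have hj : ¬ InLeg a j := fun h => (height_lt_of_inLeg h).not_gt hγ
    have hja : j ≠ a := by
      rintro rfl
      exact lt_irrefl _ hγ
    refine ⟨⟨_, x_mem_V hj t⟩, ?_, rfl⟩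
    have := actsBy_x hj t
    rw [if_neg hja] at this
    refine Units.ext ((hf this).trans ?_)
    rw [mul_zero, AddChar.map_zero_eq_one]
    rfl

end

/-! ### The midafis -/

section

variable {F : Type*} [Field F]

theorem commute_x {p q : Fin 12} (hpq : ∀ k, rootVec p + rootVec q ≠ rootVec k) (t t' : F) :
    Commute (x (posRoot p) t) (x (posRoot q) t') := by
  refine x_comm (fun γ => ?_) t t'
  obtain ⟨k, rfl⟩ := exists_posRoot γ
  exact hpq k

theorem commute_prodList {p : Fin 12} {l : List (Fin 12)}
    (h : ∀ q ∈ l, ∀ k, rootVec p + rootVec q ≠ rootVec k) (t : F) (d : Fin 12 → F) :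
    Commute (x (posRoot p) t) (prodList l d) := by
  refine Commute.list_prod_right _ _ fun g hg => ?_
  obtain ⟨q, hq, rfl⟩ := List.mem_map.1 hg
  exact commute_x (h q hq) _ _

/-- Moving `x_j` through the leg product creates only the commutator with `x_i`. That commutator
lies in `X_α` and commutes with the remaining leg factors. -/
theorem x_mul_prodList_legList {a i j : Fin 12} (hi : InLeg a i)
    (hja : rootVec j + rootVec i = rootVec a) (hai : ∀ k, rootVec a + rootVec i ≠ rootVec k)
    (h : ∀ i', InLeg a i' → i' ≠ i → (∀ k, rootVec j + rootVec i' ≠ rootVec k) ∧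
      ∀ k, rootVec a + rootVec i' ≠ rootVec k) (d : Fin 12 → F) (u : F) :
    x (posRoot j) u * prodList (legList a) d = prodList (legList a) d *
      (x (posRoot a) (structConst (rootVec j) (rootVec i) * (u * d i)) * x (posRoot j) u) := by
  obtain ⟨l₁, l₂, hl⟩ := List.append_of_mem (mem_legList.2 hi)
  have hnd : (legList a).Nodup := (List.nodup_finRange 12).filter _
  rw [hl, List.nodup_middle, List.nodup_cons, List.mem_append, not_or] at hnd
  have hmem (i') (h' : i' ∈ l₁ ∨ i' ∈ l₂) : InLeg a i' ∧ i' ≠ i := by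
    refine ⟨?_, ?_⟩
    · rw [← mem_legList, hl]
      simp only [List.mem_append, List.mem_cons]
      tauto
    · rintro rfl
      tauto
  set z := structConst (rootVec j) (rootVec i) * (u * d i) with hz
  have e : x (posRoot j) u * x (posRoot i) (d i) =
      x (posRoot i) (d i) * (x (posRoot a) z * x (posRoot j) u) := by
    rw [x_mul_x (γ := posRoot a) hja, ← mul_assoc, (commute_x hai _ _).eq, mul_assoc]
    rfl
  have h1 (i') (hi' : i' ∈ l₁ ∨ i' ∈ l₂) := h i' (hmem i' hi').1 (hmem i' hi').2
  have e1 := (commute_prodList (fun i' hi' => (h1 i' (.inl hi')).1) u d).eq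
  have e2 := (commute_prodList (fun i' hi' => (h1 i' (.inr hi')).1) u d).eq
  have e3 := (commute_prodList (fun i' hi' => (h1 i' (.inr hi')).2) z d).eq
  rw [hl, prodList_append, prodList_cons]
  calc x (posRoot j) u * (prodList l₁ d * (x (posRoot i) (d i) * prodList l₂ d)) =
      (x (posRoot j) u * prodList l₁ d) * (x (posRoot i) (d i) * prodList l₂ d) := by group
    _ = prodList l₁ d * (x (posRoot j) u * x (posRoot i) (d i)) * prodList l₂ d := by
      rw [e1]; group
    _ = prodList l₁ d * x (posRoot i) (d i) * x (posRoot a) z *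
        (x (posRoot j) u * prodList l₂ d) := by rw [e]; group
    _ = prodList l₁ d * x (posRoot i) (d i) * (x (posRoot a) z * prodList l₂ d) *
        x (posRoot j) u := by rw [e2]; group
    _ = _ := by rw [e3]; group

theorem exists_ne_of_notMem {φ : AddChar F ℂ} (hφ : φ ≠ 1) {α : PosRoot} {s : F} (hs : s ≠ 0)
    {l : V F α →* ℂˣ} (hl : IsLambda φ α s l) {w : U F} (hw : w ∉ V F α) :
    ∃ (h : V F α) (h' : w⁻¹ * h * w ∈ V F α), l h ≠ l ⟨_, h'⟩ := by
  obtain ⟨a, rfl⟩ := exists_posRoot α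
  obtain ⟨d, v, hv, rfl⟩ := exists_legList_mul a w
  obtain ⟨i, hi, hdi⟩ : ∃ i, InLeg a i ∧ d i ≠ 0 := by
    by_contra! hd
    apply hw
    rw [prodList_congr (d' := 0) fun i hi => hd i (mem_legList.1 hi)]
    refine mul_mem ?_ hv
    rw [prodList, List.prod_eq_one]
    · exact one_mem _
    · intro g hg
      obtain ⟨i, -, rfl⟩ := List.mem_map.1 hg
      exact x_zero _
  obtain ⟨j, hj, hja, hai, h⟩ := exists_arm hi
  obtain ⟨y, hy⟩ : ∃ y, φ y ≠ 1 := by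
    by_contra! hy
    exact hφ (DFunLike.ext _ _ hy)
  set N : F := (structConst (rootVec j) (rootVec i) : F) with hN
  have hN0 : N ≠ 0 := by
    have e : N * N = 1 := by
      rw [hN]
      exact_mod_cast congrArg (Int.cast : ℤ → F) (structConst_mul_self (rootVec j) (rootVec i))
    exact left_ne_zero_of_mul (e ▸ one_ne_zero)
  -- Chosen so that the extra factor `x_α(N * (u * d i))` has `λ`-value `φ y ≠ 1`.
  set u : F := y / (s * N * d i) with hu
  have key := x_mul_prodList_legList hi hja hai h d u
  rw [← hN] at key
  obtain ⟨hxa, hla⟩ := hl.1 (N * (u * d i))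
  rw [show s * (N * (u * d i)) = y by rw [hu]; field_simp] at hla
  let vV : V F (posRoot a) := ⟨v, hv⟩
  let xj : V F (posRoot a) := ⟨x (posRoot j) u, x_mem_V hj u⟩
  let xa : V F (posRoot a) := ⟨_, hxa⟩
  have hconj : (prodList (legList a) d * v)⁻¹ * x (posRoot j) u * (prodList (legList a) d * v) =
      (vV⁻¹ * (xa * xj) * vV : V F (posRoot a)) := by
    calc _ = v⁻¹ * ((prodList (legList a) d)⁻¹ * (x (posRoot j) u * prodList (legList a) d)) * v := by
          group
      _ = _ := by
          rw [key, inv_mul_cancel_left]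
          rfl
  refine ⟨xj, hconj ▸ SetLike.coe_mem _, fun e => hy ?_⟩
  have e' : l xj = l (vV⁻¹ * (xa * xj) * vV) := e.trans (congrArg l (Subtype.ext hconj))
  rw [map_mul, map_mul, map_mul, map_inv, mul_comm (l vV)⁻¹, inv_mul_cancel_right,
    right_eq_mul] at e'
  rw [← hla]
  exact congrArg Units.val e'

/-! ### Restriction of the midafis to `X_α` -/

variable (F) in
/-- The subgroup generated by the root subgroups of height larger than `n`. -/
def higher (n : ℤ) : Subgroup (U F) := ⨆ γ ∈ {γ : PosRoot | n < height γ.1}, X F γ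

theorem height_add (v w : Fin 4 → ℤ) : height (v + w) = height v + height w := by
  simp [height, Finset.sum_add_distrib]

theorem height_pos (α : PosRoot) : 0 < height α.1 := by
  obtain ⟨i, rfl⟩ := exists_posRoot α
  change 0 < height (rootVec i)
  revert i
  decide

instance (n : ℤ) : (higher F n).Normal := by
  rw [← Subgroup.normalizer_eq_top_iff, eq_top_iff, ← iSup_X]
  refine iSup_le fun α => X_le_normalizer fun β hβ γ hγ => ?_
  change n < height γ.1
  have h1 : n < height β.1 := hβ
  have h2 := height_pos α
  rw [← hγ, height_add]
  omega

/-- Adding a positive root raises the height, so `x_α(d)` commutes with all generators modulo the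
normal subgroup `higher F (height α.1)`. -/
theorem conj_x_eq (α : PosRoot) (d : F) (y : U F) :
    ∃ n ∈ higher F (height α.1), y⁻¹ * x α d * y = x α d * n := by
  let π := QuotientGroup.mk' (higher F (height α.1))
  have hle : (⊤ : Subgroup (U F)) ≤ (Subgroup.centralizer {π (x α d)}).comap π := by
    rw [← closure_range_x, Subgroup.closure_le]
    rintro _ ⟨β, t, rfl⟩
    rw [SetLike.mem_coe, Subgroup.mem_comap, Subgroup.mem_centralizer_singleton_iff, ← map_mul,
      ← map_mul]
    by_cases h : ∃ γ : PosRoot, β.1 + α.1 = γ.1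
    · obtain ⟨γ, hγ⟩ := h
      rw [x_mul_x hγ, map_mul π, (_ : π (x γ _) = 1), one_mul]
      refine (QuotientGroup.eq_one_iff _).2 ?_
      have hlt : height α.1 < height γ.1 := by
        have := height_pos β
        rw [← hγ, height_add]
        omega
      exact (le_iSup₂_of_le (f := fun γ (_ : γ ∈ {γ : PosRoot | height α.1 < height γ.1}) => X F γ)
        γ hlt le_rfl) (x_mem_X _ _)
    · rw [x_comm (not_exists.1 h)]
  have hy := hle (Subgroup.mem_top y)
  rw [Subgroup.mem_comap, Subgroup.mem_centralizer_singleton_iff, ← map_mul, ← map_mul] at hy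
  refine ⟨(x α d)⁻¹ * (y⁻¹ * x α d * y), ?_, by group⟩
  rw [← QuotientGroup.eq_one_iff]
  change π _ = 1
  rw [map_mul, mul_assoc, map_mul, ← hy, ← map_mul, ← map_mul]
  group
  exact map_one π

theorem extendChar_conj_x {φ : AddChar F ℂ} {α : PosRoot} {s : F} {l : V F α →* ℂˣ}
    (hl : IsLambda φ α s l) (d : F) (y : U F) :
    extendChar l (y⁻¹ * x α d * y) = φ (s * d) := by
  obtain ⟨n, hn, e⟩ := conj_x_eq α d y
  obtain ⟨v, hv, rfl⟩ := (iSup₂_le hl.2 : higher F (height α.1) ≤ _) hn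
  obtain ⟨hx, h⟩ := hl.1 d
  have hv' : l v = 1 := hv
  rw [e, Subgroup.coe_subtype, extendChar_mul_right, hv', Units.val_one, mul_one, ← h]
  exact extendChar_coe l ⟨x α d, hx⟩

/-- All conjugates of `x_α(d)` lie in `V_α` with the same `λ`-value, so the average is the index of
`V_α` in `U` times `φ (s * d)`. -/
theorem midafi_x [Fintype F] {φ : AddChar F ℂ} {α : PosRoot} {s : F} {l : V F α →* ℂˣ}
    (hl : IsLambda φ α s l) (d : F) :
    midafi l (x α d) = (Nat.card (V F α) : ℂ)⁻¹ * Nat.card (U F) * φ (s * d) := by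
  cases nonempty_fintype (U F)
  rw [midafi, inducedChar_eq, Finset.sum_congr rfl fun y _ => extendChar_conj_x hl d y,
    Finset.sum_const, nsmul_eq_mul, Finset.card_univ, Nat.card_eq_fintype_card (α := U F), mul_assoc]

end

end D4

/-! ### The proposition -/

theorem proposition3p3 {F : Type*} [Field F] [Fintype F] (φ : AddChar F ℂ) (hφ : φ ≠ 1)
    (α : D4.PosRoot) :
    (D4.V F α : Set (D4.U F)) = D4.prodSet F α ∧
    (∀ s : Fˣ, ∃ l : D4.V F α →* ℂˣ, D4.IsLambda φ α s l) ∧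
    ∀ l : Fˣ → (D4.V F α →* ℂˣ), (∀ s : Fˣ, D4.IsLambda φ α s (l s)) →
      (∀ s : Fˣ, IsIrreducibleChar (D4.midafi (l s))) ∧
      Function.Injective (fun s : Fˣ => D4.midafi (l s)) ∧
      (Set.range fun s : Fˣ => D4.midafi (l s)).ncard = Fintype.card F - 1 ∧
      ∀ (s : Fˣ) (d : F),
        D4.midafi (l s) (D4.x α d) = D4.midafi (l s) 1 * φ (s * d) := by
  refine ⟨D4.coe_V α, fun s => D4.exists_isLambda φ α s, fun l hl => ?_⟩
  have hinj : Function.Injective (fun s : Fˣ => D4.midafi (l s)) := by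
    intro s s' h
    by_contra hne
    apply hφ
    have hd (d : F) : φ (s * d) = φ (s' * d) := by
      have h1 := congrFun h (D4.x α d)
      simp only [D4.midafi_x (hl _)] at h1
      refine mul_left_cancel₀ (mul_ne_zero (inv_ne_zero ?_) ?_) h1 <;>
        exact Nat.cast_ne_zero.2 Nat.card_pos.ne'
    have hne' : (s : F) - s' ≠ 0 := sub_ne_zero.2 fun e => hne (Units.ext e)
    refine DFunLike.ext _ _ fun y => ?_
    -- With this argument the two sides of `hd` differ by the factor `φ y`, so `φ` would be trivial.
    have h2 := hd (y / (s - s'))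
    have h3 : (s : F) * (y / (s - s')) = y + s' * (y / (s - s')) := by
      field_simp
      ring
    rw [h3, AddChar.map_add_eq_mul] at h2
    have h4 : φ (s' * (y / (s - s'))) ≠ 0 := (AddChar.val_isUnit φ _).ne_zero
    simpa [h4] using h2
  refine ⟨fun s => ?_, hinj, ?_, fun s d => ?_⟩
  · cases nonempty_fintype (D4.U F)
    exact isIrreducibleChar_inducedChar (l s) fun w hw =>
      D4.exists_ne_of_notMem hφ s.ne_zero (hl s) hw
  · rw [Set.ncard_range_of_injective hinj, Nat.card_units, Nat.card_eq_fintype_card]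
  · have h1 := D4.midafi_x (hl s) 0
    rw [D4.x_zero, mul_zero, AddChar.map_zero_eq_one, mul_one] at h1
    rw [h1, D4.midafi_x (hl s) d]
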